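/- Let $(X, X^*, R, \check R)$ be a (finite, crystallographic) root system, where $X$ is a real vector space with dual $X^*$, the roots $R\subset X^*$ span $X^*$ and the coroots $\check R\subset X$ span $X$. Let $W$ be its Weyl group, acting on $X$ and on $X^*$, let $\varepsilon=\det\colon W\to\{\pm1\}$ be its sign character, and assume $-1\in W$. Call $x\in X$ (resp. $\lambda\in X^*$) regular if no root (resp. coroot) vanishes on it. The stable discrete series constants $\bar c_R(x,\lambda)\in\mathbb Z$, for $x\in X$ and $\lambda\in X^*$ regular, are determined, by induction on $\dim X$, by the following rules. (a) If $\dim X=0$, then $\bar c_R(x,\lambda)=1$. (b) If $\dim X>0$ and $\lambda$ lies in the chamber of $X^*$ dual to the chamber of $x$ (that is, for every $\alpha\in R$ the numbers $\alpha(x)$ and $\lambda(\check\alpha)$ have the same sign), then $\bar c_R(x,\lambda)=0$. (c) If $x$ and $x'$ lie in adjacent chambers of $X$, separated by the root hyperplane $Y$, and $y$ lies in the interior of their common face, then $$\bar c_R(x,\lambda)+\bar c_R(x',\lambda)=2\,\bar c_{R_Y}(y,\lambda|_Y),$$ where $R_Y$ is the root system on $Y$ whose set of coroots is $\check R\cap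 Y$. Let $x_0\in X$ and $\lambda\in X^*$ be regular. Then the rules (a)-(c) determine a unique integer $\bar c_R(x_0,\lambda)$, and the following hold. (i) $\displaystyle\sum_{w\in W}\bar c_R(wx_0,\lambda)=|W|$ and $\displaystyle\sum_{w\in W}\bar c_R(x_0,w\lambda)=|W|.$ (ii) Suppose moreover that $R$ is reduced, and put $q(R)=\tfrac12\left(|R^+|+\dim X\right)$, where $R^+$ is a set of positive roots of $R$. If $\lambda$ lies in the chamber of $X^*$ dual to the chamber of $x_0$, then $$\sum_{w\in W}\varepsilon(w)\,\bar c_R(wx_0,\lambda)=(-1)^{q(R)}|W|\quad\text{and}\quad \sum_{w\in W}\varepsilon(w)\,\bar c_R(x_0,w\lambda)=(-1)^{q(R)}|W|.$$ -/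

import Mathlib

noncomputable section

namespace StableConstants

variable {ι V X : Type*} [AddCommGroup V] [Module ℝ V] [AddCommGroup X] [Module ℝ X]

/-! Throughout, `P : RootPairing ι ℝ V X`: the roots `P.root i` lie in `V`, which plays the role of
`X^*` through the perfect pairing `P.toLinearMap`, and the coroots `P.coroot i` lie in `X`.
`P.root' i x` is the value of the root `i` at `x : X`, and `P.coroot' i v` is the value of
`v : V`, as a linear form on `X`, at the coroot `i`. -/

/-- `x : X` is regular: it lies on no root hyperplane. -/
def IsRegular (P : RootPairing ι ℝ V X) (x : X) : Prop :=
  ∀ i, P.root' i x ≠ 0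

/-- `lam : X^*` is regular: it lies on no coroot hyperplane. -/
def IsDualRegular (P : RootPairing ι ℝ V X) (lam : V) : Prop :=
  ∀ i, P.coroot' i lam ≠ 0

/-- For regular `x`: `lam` lies in the chamber of `X^*` dual to the chamber of `x`, that is,
`⟨lam, α^∨⟩ > 0` for every root `α` which is positive on the chamber of `x`. -/
def InDualChamber (P : RootPairing ι ℝ V X) (x : X) (lam : V) : Prop :=
  ∀ i, 0 < P.root' i x → 0 < P.coroot' i lam

/-- The linear action of an automorphism `w` of the root system on `X`, contragredient to its
action `w • v` on `V = X^*`. (`coweightEquiv w` is the transpose of the action on `V`.) -/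
def act (P : RootPairing ι ℝ V X) (w : P.Aut) : X ≃ₗ[ℝ] X :=
  RootPairing.Equiv.coweightEquiv P P w⁻¹

theorem toLinearMap_smul_act (P : RootPairing ι ℝ V X) (w : P.Aut) (v : V) (x : X) :
    P.toLinearMap (w • v) (act P w x) = P.toLinearMap v x := by
  have h := LinearMap.congr_fun
    (LinearMap.congr_fun (w⁻¹).weight_coweight_transpose x) (w • v)
  have h2 : w⁻¹ • (w • v) = v := inv_smul_smul w v
  have h3 : P.toLinearMap (w • v) (act P w x) = P.toLinearMap (w⁻¹ • (w • v)) x := h.symm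
  rw [h3, h2]

theorem act_reflection (P : RootPairing ι ℝ V X) (i : ι) :
    act P (RootPairing.Equiv.reflection P i) = P.coreflection i := by
  unfold act
  rw [RootPairing.Equiv.reflection_inv, RootPairing.Equiv.reflection_coweightEquiv]

/-- The sign character `ε` of the Weyl group: the determinant of the action on `X`. -/
def eps (P : RootPairing ι ℝ V X) (w : P.Aut) : ℝ :=
  LinearMap.det (act P w : X →ₗ[ℝ] X)

/-- `-1` belongs to the Weyl group. -/
def NegOneMemWeyl (P : RootPairing ι ℝ V X) : Prop :=
  ∃ w ∈ P.weylGroup, ∀ x : X, act P w x = -x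

/-- The Weyl group of a finite root system is finite. -/
instance finite_weylGroup (P : RootPairing ι ℝ V X) [Finite ι] [P.IsRootSystem] :
    Finite P.weylGroup := by
  have hinj : Function.Injective (fun w : P.weylGroup => RootPairing.Equiv.indexHom P w.1) := by
    rintro ⟨w, hw⟩ ⟨w', hw'⟩ h
    apply Subtype.ext
    apply RootPairing.Equiv.weightHom_injective P
    apply LinearEquiv.toLinearMap_injective
    apply LinearMap.ext_on_range (v := P.root) RootPairing.IsRootSystem.span_root_eq_top
    intro i
    have h1 := RootPairing.Equiv.root_indexEquiv_eq_smul (P := P) i w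
    have h2 := RootPairing.Equiv.root_indexEquiv_eq_smul (P := P) i w'
    have h3 : w.indexEquiv i = w'.indexEquiv i := congrArg (fun e => e i) h
    rw [h3, h2] at h1
    exact h1.symm
  exact Finite.of_injective _ hinj

instance fintype_weylGroup (P : RootPairing ι ℝ V X) [Finite ι] [P.IsRootSystem] :
    Fintype P.weylGroup :=
  Fintype.ofFinite _

/-- `q(R) = (|R⁺| + dim X) / 2`, where `R⁺` is the set of roots which are positive at the regular
element `x`. The number does not depend on `x`, and the division is exact when `-1` belongs to
the Weyl group and the root system is reduced. -/
def qR (P : RootPairing ι ℝ V X) (x : X) : ℕ :=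
  (Set.ncard {i | 0 < P.root' i x} + Module.finrank ℝ X) / 2

/-- The hyperplane `Y = ker α` of the root `i = α` is a common wall of the two chambers of `x` and
`x'` for the set `S` of roots, and `y` lies in the relative interior of their common face in `Y`:
`x` and `x'` lie strictly on opposite sides of `Y`, whereas all roots of `S` that do not define
`Y` take values of the same strict sign at `x`, `x'` and `y`. -/
def IsCommonFace (P : RootPairing ι ℝ V X) (S : Set ι) (i : ι) (x x' y : X) : Prop :=
  P.root' i y = 0 ∧ ∀ j ∈ S,
    (P.root j ∈ Submodule.span ℝ {P.root i} → P.root' j x * P.root' j x' < 0) ∧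
    (P.root j ∉ Submodule.span ℝ {P.root i} →
      0 < P.root' j x * P.root' j y ∧ 0 < P.root' j x' * P.root' j y)

/-- The roots in `S` whose coroot lies in the hyperplane `Y = ker α` of the root `i = α`. Restricted
to `Y`, these roots form the root system `R_Y` on `Y`. -/
def wallRoots (P : RootPairing ι ℝ V X) (S : Set ι) (i : ι) : Set ι :=
  {j ∈ S | P.root' i (P.coroot j) = 0}

/-- The rules that determine the stable discrete series constants. Here `S` is the root system `R`
(`S = univ`) or the root system `R_Y` on an iterated hyperplane `Y ⊆ X`, written as a set of
roots of `R`, and `IsStableConst P lam S x n` says that the rules give the value `n` for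
`c̄_S(x, lam|_Y)`, `x ∈ Y`. (Only the values of the roots of `S` at `x` and of `lam` at their
coroots enter, so nothing changes if `x` is moved off `Y` within the same signs.)
* In rank `0` the constant is `1`.
* In positive rank the constant vanishes if `lam` lies in the chamber dual to that of `x`.
* If `x` and `x'` lie in adjacent chambers, with common wall `Y`, and `y` lies in the interior of
  their common face, then `c̄_R(x, lam) + c̄_R(x', lam) = 2 c̄_{R_Y}(y, lam|_Y)`. -/
inductive IsStableConst (P : RootPairing ι ℝ V X) (lam : V) : Set ι → X → ℤ → Prop
  | rank_zero (S : Set ι) (x : X) (hS : S = ∅) : IsStableConst P lam S x 1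
  | vanishing (S : Set ι) (x : X) (hS : S.Nonempty)
      (h : ∀ j ∈ S, 0 < P.root' j x * P.coroot' j lam) : IsStableConst P lam S x 0
  | wall_crossing (S : Set ι) (i : ι) (hi : i ∈ S) (x x' y : X)
      (hface : IsCommonFace P S i x x' y) (a b : ℤ)
      (ha : IsStableConst P lam (wallRoots P S i) y a)
      (hb : IsStableConst P lam S x' b) : IsStableConst P lam S x (2 * a - b)

/-- The stable discrete series constant `c̄_R(x, lam)`: the integer which the rules give for the
whole root system. -/
def stableConst (P : RootPairing ι ℝ V X) (x : X) (lam : V) : ℤ :=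
  Classical.epsilon fun n => IsStableConst P lam Set.univ x n

end StableConstants

end

/-!
The rules are solved by an explicit formula. Normalize the coroots to length one for a
Weyl-invariant scalar product on `X`, so that a root system becomes a finite set `Φ` of unit vectors
closed under its reflections, and represent `lam` by a vector `L`. Then the constant of the chambers
of `x` and `L` is
`∑ σ, I ^ dim (Fix σ) * ∏ b, factor σ L x b`,
where `σ` runs over the involutions of the Weyl group (with `1`) and `b` over the roots positive at
`L`. The factor is `1` if `σ b = -b`; otherwise it is the sign of `b` at `x`, times the imaginary
unit if `b` is fixed or made negative by `σ`.

*Wall crossing* (`IsUnitSystem.formula_add`). Let `x` and `x'` be separated by the wall of `a`. If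
`σ a ≠ -a`, the factor of `a` changes sign and the two summands cancel. The involutions with
`σ a = -a` correspond, through `σ ↦ σ * refl a`, to the involutions of the reflection group of the
roots orthogonal to `a`; here one uses that the stabilizer of `a` is generated by reflections
(`IsUnitSystem.mem_reflGroup_perp`). The roots which are neither proportional nor orthogonal to `a`
have product of factors `1` (`IsUnitSystem.prod_factor_eq_one`), because the group generated by `σ`
and `refl a` permutes them and they cancel in pairs. Hence the two summands agree with those of the
smaller system.

*Vanishing for `x = L`* (`IsUnitSystem.formula_self_eq_zero`). Choose a simple root `a` of the
chamber of `L`. Conjugation by `refl a` reverses the sign of the summand when `σ a ≠ a, -a`. The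
involutions which negate `a` and those which fix `a` both add up to the formula for the roots
orthogonal to `a`, up to a sign for the second kind which does not depend on `σ`. So the formula is
a multiple of the formula for a smaller system, where induction applies; if that system is empty,
then all roots are proportional to `a`, and the multiple is `0`.

*Uniqueness and existence.* By induction on the derivation, every value given by the rules is the
value of the formula (`IsStableConst.eq_formula`). A value exists
(`exists_isStableConst`) since a generic segment from `x` towards the chamber dual to `lam` first
crosses a single wall (`exists_separating_wall`).

*Sums over orbits.* The summand of `σ` depends on `x` only through the product of the signs at `x`
of the positive roots which `σ` does not negate. If `σ ≠ -1`, then `-σ ≠ 1` is an involution and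
negates some root (`IsUnitSystem.exists_apply_eq_neg`), which `σ` fixes; the reflection in that root
reverses the product, and the sum over the orbit is `0`. The summand of `-1` is `1`, which proves
(i). Multiplication by the sign character replaces the product by that over the roots which `σ`
negates, and now only `σ = 1` survives, with the constant summand `I ^ (|R⁺| + dim X)`. As the sum
is real, the exponent is even, and this is `(-1) ^ q(R)`. The sums over the orbit of `lam` reduce to
those over the orbit of `x`, since the formula is invariant under the simultaneous action on `x`
and `L`.
-/

noncomputable section

namespace StableConstants

open Module Filter Topology
open scoped RealInnerProductSpace

/-! ### Generic segments between chambers -/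

theorem eventually_pos_mul_add_mul {a : ℝ} (ha : a ≠ 0) (b : ℝ) :
    ∀ᶠ t : ℝ in 𝓝[>] 0, 0 < a * (a + t * b) := by
  have hc : Continuous fun t : ℝ => a * (a + t * b) := by fun_prop
  have h0 : (0 : ℝ) < a * (a + 0 * b) := by
    have := mul_self_pos.2 ha
    simpa using this
  exact nhdsWithin_le_nhds (hc.continuousAt.eventually (lt_mem_nhds h0))

theorem eventually_add_mul_ne_zero (a : ℝ) {b : ℝ} (hb : b ≠ 0) :
    ∀ᶠ t : ℝ in 𝓝[>] 0, a + t * b ≠ 0 := by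
  rcases eq_or_ne a 0 with rfl | ha
  · filter_upwards [self_mem_nhdsWithin] with t ht
    have : t ≠ 0 := ne_of_gt ht
    simp [this, hb]
  · filter_upwards [eventually_pos_mul_add_mul ha b] with t ht h
    simp [h] at ht

theorem sub_ne_zero_of_mul_neg {a b : ℝ} (h : a * b < 0) : a - b ≠ 0 := by
  intro h0
  rw [sub_eq_zero.1 h0] at h
  exact (mul_self_nonneg b).not_gt h

theorem div_sub_mem_Ioo_of_mul_neg {a b : ℝ} (h : a * b < 0) : a / (a - b) ∈ Set.Ioo 0 1 := by
  rcases mul_neg_iff.1 h with ⟨ha, hb⟩ | ⟨ha, hb⟩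
  · have : 0 < a - b := by linarith
    exact ⟨div_pos ha this, (div_lt_one this).2 (by linarith)⟩
  · have : a - b < 0 := by linarith
    exact ⟨div_pos_of_neg_of_neg ha this, (div_lt_one_of_neg this).2 (by linarith)⟩

/-- A wall of the chamber of `x` which separates it from the chamber of `z`. For a finite family of
linear forms, move `z` slightly so that the segment from `x` to `z` meets at most one hyperplane at
a time; the first hyperplane met is a wall, `y` is the crossing point, and `x'` lies just beyond. -/
theorem exists_separating_wall {κ U : Type*} [AddCommGroup U] [Module ℝ U] {S : Set κ}
    (hS : S.Finite) (f : κ → Dual ℝ U) {x z : U} (hx : ∀ j ∈ S, f j x ≠ 0)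
    (hz : ∀ j ∈ S, f j z ≠ 0) (hsep : ∃ j ∈ S, f j x * f j z < 0) :
    ∃ i ∈ S, f i x * f i z < 0 ∧ ∃ x' y, f i y = 0 ∧ ∀ j ∈ S,
      (f j ∈ Submodule.span ℝ {f i} → f j x * f j x' < 0) ∧
      (f j ∉ Submodule.span ℝ {f i} → 0 < f j x * f j y ∧ 0 < f j x' * f j y) := by
  classical
  have := hS.to_subtype
  let g : κ → κ → Dual ℝ U := fun j k => f j x • f k - f k x • f j
  have hg : ∀ q : {q : S × S // f q.1 ∉ Submodule.span ℝ {f q.2}},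
      ∃ p, g q.1.1 q.1.2 p ≠ 0 := by
    rintro ⟨⟨⟨j, hj⟩, ⟨k, hk⟩⟩, hjk⟩
    by_contra! h
    apply hjk
    have h0 : f j x • f k - f k x • f j = 0 := LinearMap.ext h
    rw [Submodule.mem_span_singleton]
    refine ⟨(f k x)⁻¹ * f j x, ?_⟩
    rw [mul_smul, sub_eq_zero.1 h0, smul_smul, inv_mul_cancel₀ (hx k hk), one_smul]
  obtain ⟨p, hp⟩ := Dual.exists_forall_ne_zero_of_forall_exists
    (fun q : {q : S × S // f q.1 ∉ Submodule.span ℝ {f q.2}} => g q.1.1 q.1.2) hg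
  have h1 : ∀ᶠ t : ℝ in 𝓝[>] 0, ∀ j ∈ S, 0 < f j z * (f j z + t * f j p) :=
    (hS.eventually_all).2 fun j hj => eventually_pos_mul_add_mul (hz j hj) _
  have h2 : ∀ᶠ t : ℝ in 𝓝[>] 0, ∀ q : {q : S × S // f q.1 ∉ Submodule.span ℝ {f q.2}},
      g q.1.1 q.1.2 z + t * g q.1.1 q.1.2 p ≠ 0 :=
    Filter.eventually_all.2 fun q => eventually_add_mul_ne_zero _ (hp q)
  obtain ⟨t, ht1, ht2⟩ := (h1.and h2).exists
  -- `v` lies in the chamber of `z`, in general position with respect to `x`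
  set v : U := z + t • p with hv
  have hv1 : ∀ j ∈ S, 0 < f j z * f j v := fun j hj => by simpa [hv] using ht1 j hj
  have hv2 : ∀ j ∈ S, ∀ k ∈ S, f j ∉ Submodule.span ℝ {f k} →
      f j x * f k v ≠ f k x * f j v := by
    intro j hj k hk hjk h
    apply ht2 ⟨⟨⟨j, hj⟩, ⟨k, hk⟩⟩, hjk⟩
    have : g j k v = 0 := by simp [g, h]
    simpa [hv] using this
  -- the parameter at which the segment from `x` to `v` meets the hyperplane of `j`
  let τ : κ → ℝ := fun j => f j x / (f j x - f j v)
  obtain ⟨j0, hj0, hj0s⟩ := hsep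
  have hsepv : ∀ j ∈ S, f j x * f j z < 0 → f j x * f j v < 0 := by
    intro j hj h
    have h1 := hv1 j hj
    by_contra! h2
    nlinarith [mul_nonneg h1.le h2, sq_nonneg (f j v), mul_neg_of_neg_of_pos h h1,
      sq_pos_of_ne_zero (right_ne_zero_of_mul h1.ne')]
  obtain ⟨i, ⟨hi, his⟩, hmin⟩ := Set.exists_min_image {j | j ∈ S ∧ f j x * f j z < 0} τ
    (hS.subset fun j h => h.1) ⟨j0, hj0, hj0s⟩
  set T := τ i with hT
  have hfv : f i x * f i v < 0 := hsepv i hi his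
  have hne : f i x - f i v ≠ 0 := sub_ne_zero_of_mul_neg hfv
  have hTi : T * (f i x - f i v) = f i x := div_mul_cancel₀ _ hne
  have hT01 : 0 < T ∧ T < 1 := div_sub_mem_Ioo_of_mul_neg hfv
  set y : U := x + T • (v - x) with hy
  have hyj : ∀ j, f j y = f j x + T * (f j v - f j x) := fun j => by simp [hy]
  have hyi : f i y = 0 := by rw [hyj]; linarith
  have hside : ∀ j ∈ S, f j ∉ Submodule.span ℝ {f i} → 0 < f j x * f j y := by
    intro j hj hji
    rw [hyj]
    have hxj := sq_pos_of_ne_zero (hx j hj)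
    by_cases hs : f j x * f j z < 0
    · have hs' := hsepv j hj hs
      have hle : T ≤ τ j := hmin j ⟨hj, hs⟩
      have hne' : f j x - f j v ≠ 0 := sub_ne_zero_of_mul_neg hs'
      have hτ : τ j * (f j x - f j v) = f j x := div_mul_cancel₀ _ hne'
      have hlt : T < τ j := by
        refine lt_of_le_of_ne hle fun h => hv2 j hj i hi hji ?_
        rw [← h] at hτ
        -- both crossings at the same parameter contradict general position
        have e1 : T * f i v = (T - 1) * f i x := by linarith
        have e2 : T * f j v = (T - 1) * f j x := by linarith
        apply mul_left_cancel₀ hT01.1.ne'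
        linear_combination f j x * e1 - f i x * e2
      have hpos : 0 < f j x * (f j x - f j v) := by nlinarith
      have : f j x * (f j x + T * (f j v - f j x))
          = (τ j - T) * (f j x * (f j x - f j v)) := by
        linear_combination (-f j x) * hτ
      rw [this]
      exact mul_pos (sub_pos.2 hlt) hpos
    · have hz' : 0 < f j x * f j z :=
        lt_of_le_of_ne (not_lt.1 hs) (mul_ne_zero (hx j hj) (hz j hj)).symm
      have hv' : 0 < f j x * f j v := by
        have h1 := hv1 j hj
        have := mul_pos hz' h1
        have h3 := sq_pos_of_ne_zero (hz j hj)
        by_contra! h2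
        nlinarith
      nlinarith [hT01.1, hT01.2, mul_pos hT01.1 hv', mul_pos (sub_pos.2 hT01.2) hxj]
  have h3 : ∀ᶠ t : ℝ in 𝓝[>] 0, ∀ j ∈ S, f j ∉ Submodule.span ℝ {f i} →
      0 < f j y * (f j y + t * f j (v - x)) := by
    refine (hS.eventually_all).2 fun j hj => ?_
    by_cases hji : f j ∉ Submodule.span ℝ {f i}
    · filter_upwards [eventually_pos_mul_add_mul
        (right_ne_zero_of_mul (hside j hj hji).ne') (f j (v - x))] with t ht _ using ht
    · exact Eventually.of_forall fun _ h => absurd h hji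
  obtain ⟨δ, hδ, hδ0⟩ := (h3.and self_mem_nhdsWithin).exists
  have hδ0 : 0 < δ := hδ0
  refine ⟨i, hi, his, y + δ • (v - x), y, hyi, fun j hj => ⟨fun hji => ?_, fun hji => ?_⟩⟩
  · obtain ⟨c, hc⟩ := Submodule.mem_span_singleton.1 hji
    have hcj : ∀ u, f j u = c * f i u := fun u => by rw [← hc]; simp
    have hc0 : c ≠ 0 := by
      rintro rfl
      exact hx j hj (by simp [hcj])
    rw [hcj, hcj]
    have e : f i (y + δ • (v - x)) = δ * (f i v - f i x) := by simp [hyi]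
    rw [e]
    have hneg : f i x * (f i v - f i x) < 0 := by nlinarith [sq_nonneg (f i x)]
    have := mul_neg_of_pos_of_neg (mul_pos (sq_pos_of_ne_zero hc0) hδ0) hneg
    nlinarith
  · refine ⟨hside j hj hji, ?_⟩
    have := hδ j hj hji
    rw [map_add, map_smul, smul_eq_mul, mul_comm]
    exact this

section UnitSystem

variable {E : Type*} [NormedAddCommGroup E] [InnerProductSpace ℝ E]

/-! ### Systems of unit roots and their reflection groups -/

/-- The orthogonal reflection in the hyperplane `a^⊥`. -/
def refl (a : E) : E ≃ₗᵢ[ℝ] E := (ℝ ∙ a)ᗮ.reflection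

theorem refl_apply {a : E} (ha : ‖a‖ = 1) (x : E) : refl a x = x - (2 * ⟪a, x⟫) • a := by
  rw [refl, Submodule.reflection_orthogonal_apply, Submodule.reflection_singleton_apply, ha]
  simp only [one_pow, div_one, RCLike.ofReal_real_eq_id, id]
  module

theorem refl_self (a : E) : refl a a = -a :=
  Submodule.reflection_orthogonalComplement_singleton_eq_neg a

theorem refl_refl (a x : E) : refl a (refl a x) = x :=
  Submodule.reflection_reflection _ x

theorem refl_mul_self (a : E) : refl a * refl a = 1 :=
  Submodule.reflection_mul_reflection _

theorem refl_inv (a : E) : (refl a)⁻¹ = refl a :=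
  Submodule.reflection_inv

theorem inner_refl_left (a x y : E) : ⟪refl a x, y⟫ = ⟪x, refl a y⟫ := by
  rw [← LinearIsometryEquiv.inner_map_map (refl a), refl_refl]

theorem inner_inv_left (w : E ≃ₗᵢ[ℝ] E) (x y : E) : ⟪w⁻¹ x, y⟫ = ⟪x, w y⟫ := by
  rw [← LinearIsometryEquiv.inner_map_map w]
  congr 1
  exact w.apply_symm_apply x

theorem refl_of_inner_eq_zero {a x : E} (ha : ‖a‖ = 1) (h : ⟪a, x⟫ = 0) : refl a x = x := by
  rw [refl_apply ha, h]
  simp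

theorem refl_neg (a : E) : refl (-a) = refl a := by
  unfold refl
  congr 2
  rw [← Set.neg_singleton, Submodule.span_neg]

theorem mul_refl_mul_inv (w : E ≃ₗᵢ[ℝ] E) {a : E} (ha : ‖a‖ = 1) :
    w * refl a * w⁻¹ = refl (w a) := by
  ext x
  have hwa : ‖w a‖ = 1 := by rw [w.norm_map, ha]
  have h1 : (w * refl a * w⁻¹) x = w (refl a (w⁻¹ x)) := rfl
  have h2 : w (w⁻¹ x) = x := w.apply_symm_apply x
  have h3 : ⟪a, w⁻¹ x⟫ = ⟪w a, x⟫ := by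
    rw [real_inner_comm, inner_inv_left, real_inner_comm]
  rw [h1, refl_apply ha, refl_apply hwa, map_sub, map_smul, h2, h3]

theorem inner_self_of_norm_one {a : E} (ha : ‖a‖ = 1) : ⟪a, a⟫ = 1 := by
  rw [real_inner_self_eq_norm_sq, ha, one_pow]

theorem eq_or_eq_neg_of_eq_smul {a b : E} (ha : ‖a‖ = 1) (hb : ‖b‖ = 1) {c : ℝ}
    (h : b = c • a) : b = a ∨ b = -a := by
  have hc : |c| = 1 := by
    have := congrArg norm h
    rwa [norm_smul, ha, hb, mul_one, Real.norm_eq_abs, eq_comm] at this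
  rcases eq_or_eq_neg_of_abs_eq hc with rfl | rfl
  · left; rw [h, one_smul]
  · right; rw [h, neg_one_smul]

theorem innerₗ_mem_span_singleton {a b : E} (ha : ‖a‖ = 1) (hb : ‖b‖ = 1) :
    innerₗ E b ∈ Submodule.span ℝ {innerₗ E a} ↔ b = a ∨ b = -a := by
  rw [Submodule.mem_span_singleton]
  constructor
  · rintro ⟨c, hc⟩
    refine eq_or_eq_neg_of_eq_smul ha hb (c := c) (ext_inner_right ℝ fun v => ?_)
    have := LinearMap.congr_fun hc v
    simpa [inner_smul_left] using this.symm
  · rintro (rfl | rfl)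
    · exact ⟨1, one_smul _ _⟩
    · exact ⟨-1, by simp⟩

theorem exists_forall_inner_ne_zero {κ : Type*} [Finite κ] (v : κ → E) (hv : ∀ k, v k ≠ 0) :
    ∃ p, ∀ k, ⟪v k, p⟫ ≠ 0 :=
  Dual.exists_forall_ne_zero_of_forall_exists (fun k => innerₗ E (v k))
    fun k => ⟨v k, by simpa using hv k⟩

/-- A finite system of unit vectors which is closed under its reflections. Normalizing the
coroots of a root system makes proportional roots coincide, so that such a system has exactly two
opposite members for each root hyperplane. -/
structure IsUnitSystem (Φ : Finset E) : Prop where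
  norm_one : ∀ a ∈ Φ, ‖a‖ = 1
  refl_mem : ∀ a ∈ Φ, ∀ b ∈ Φ, refl a b ∈ Φ

/-- The group generated by the reflections in the members of `Φ`. -/
def reflGroup (Φ : Finset E) : Subgroup (E ≃ₗᵢ[ℝ] E) :=
  Subgroup.closure (refl '' (Φ : Set E))

/-- The members of `Φ` orthogonal to `v`. -/
def perp (Φ : Finset E) (v : E) : Finset E :=
  open Classical in Φ.filter fun b => ⟪b, v⟫ = 0

theorem mem_perp {Φ : Finset E} {v b : E} : b ∈ perp Φ v ↔ b ∈ Φ ∧ ⟪b, v⟫ = 0 := by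
  simp [perp]

theorem perp_neg (Φ : Finset E) (v : E) : perp Φ (-v) = perp Φ v := by
  ext; simp [mem_perp]

/-- No member of `Φ` is orthogonal to `x`. -/
def Regular (Φ : Finset E) (x : E) : Prop := ∀ b ∈ Φ, ⟪b, x⟫ ≠ 0

theorem refl_mem_reflGroup {Φ : Finset E} {a : E} (ha : a ∈ Φ) : refl a ∈ reflGroup Φ :=
  Subgroup.subset_closure ⟨a, ha, rfl⟩

theorem reflGroup_le {Φ Ψ : Finset E} (h : Φ ⊆ Ψ) : reflGroup Φ ≤ reflGroup Ψ :=
  Subgroup.closure_mono (Set.image_mono (by simpa using h))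

theorem reflGroup_induction {Φ : Finset E} {p : (E ≃ₗᵢ[ℝ] E) → Prop} (h1 : p 1)
    (hmul : ∀ a ∈ Φ, ∀ w, p w → p (refl a * w)) {w : E ≃ₗᵢ[ℝ] E} (hw : w ∈ reflGroup Φ) : p w := by
  refine Subgroup.closure_induction_left (p := fun w _ => p w) h1 ?_ ?_ hw
  · rintro _ ⟨a, ha, rfl⟩ w _ h
    exact hmul a ha w h
  · rintro _ ⟨a, ha, rfl⟩ w _ h
    rw [refl_inv]
    exact hmul a ha w h

namespace IsUnitSystem

variable {Φ : Finset E} (hΦ : IsUnitSystem Φ)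
include hΦ

theorem neg_mem {a : E} (ha : a ∈ Φ) : -a ∈ Φ := by
  rw [← refl_self]
  exact hΦ.refl_mem a ha a ha

theorem ne_zero {a : E} (ha : a ∈ Φ) : a ≠ 0 := by
  rintro rfl
  simpa using hΦ.norm_one 0 ha

theorem self_ne_neg {a : E} (ha : a ∈ Φ) : a ≠ -a := by
  intro h
  have h2 := eq_neg_iff_add_eq_zero.1 h
  rw [← two_smul ℝ] at h2
  exact hΦ.ne_zero ha (by simpa using h2)

theorem apply_mem {w : E ≃ₗᵢ[ℝ] E} (hw : w ∈ reflGroup Φ) : ∀ b ∈ Φ, w b ∈ Φ := by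
  refine reflGroup_induction (p := fun w => ∀ b ∈ Φ, w b ∈ Φ) (fun b hb => hb) ?_ hw
  intro a ha w h b hb
  exact hΦ.refl_mem a ha _ (h b hb)

theorem perp (v : E) : IsUnitSystem (perp Φ v) where
  norm_one a ha := hΦ.norm_one a (mem_perp.1 ha).1
  refl_mem a ha b hb := by
    rw [mem_perp] at *
    refine ⟨hΦ.refl_mem a ha.1 b hb.1, ?_⟩
    rw [inner_refl_left, refl_of_inner_eq_zero (hΦ.norm_one a ha.1) ha.2, hb.2]

theorem sub_mem_span {w : E ≃ₗᵢ[ℝ] E} (hw : w ∈ reflGroup Φ) :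
    ∀ x, w x - x ∈ Submodule.span ℝ (Φ : Set E) := by
  refine reflGroup_induction (p := fun w => ∀ x, w x - x ∈ Submodule.span ℝ (Φ : Set E))
    (fun x => by simp) ?_ hw
  intro a ha w h x
  have e : (refl a * w) x - x = (w x - x) - (2 * ⟪a, w x⟫) • a := by
    have : (refl a * w) x = refl a (w x) := rfl
    rw [this, refl_apply (hΦ.norm_one a ha)]
    abel
  rw [e]
  exact Submodule.sub_mem _ (h x) (Submodule.smul_mem _ _ (Submodule.subset_span ha))

theorem apply_eq_self {w : E ≃ₗᵢ[ℝ] E} (hw : w ∈ reflGroup Φ) {x : E}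
    (hx : ∀ b ∈ Φ, ⟪b, x⟫ = 0) : w x = x := by
  refine reflGroup_induction (p := fun w => w x = x) rfl ?_ hw
  intro a ha w h
  have : (refl a * w) x = refl a (w x) := rfl
  rw [this, h, refl_of_inner_eq_zero (hΦ.norm_one a ha) (hx a ha)]

theorem ext_on {w w' : E ≃ₗᵢ[ℝ] E} (hw : w ∈ reflGroup Φ) (hw' : w' ∈ reflGroup Φ)
    (h : ∀ b ∈ Φ, w b = w' b) : w = w' := by
  ext x
  have := FiniteDimensional.span_finset ℝ Φ
  obtain ⟨u, hu, v, hv, rfl⟩ := (Submodule.span ℝ (Φ : Set E)).exists_add_mem_mem_orthogonal x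
  have hv0 : ∀ b ∈ Φ, ⟪b, v⟫ = 0 := fun b hb => hv b (Submodule.subset_span hb)
  have hu0 : w u = w' u := by
    have : Set.EqOn w.toLinearEquiv.toLinearMap w'.toLinearEquiv.toLinearMap (Φ : Set E) :=
      fun b hb => h b hb
    exact LinearMap.eqOn_span this hu
  rw [map_add, map_add, hu0, hΦ.apply_eq_self hw hv0, hΦ.apply_eq_self hw' hv0]

theorem finite_reflGroup : (reflGroup Φ : Set (E ≃ₗᵢ[ℝ] E)).Finite := by
  have hinj : Function.Injective (fun w : reflGroup Φ =>
      (fun b : Φ => (⟨w.1 b.1, hΦ.apply_mem w.2 b.1 b.2⟩ : Φ))) := by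
    intro w w' h
    apply Subtype.ext
    refine hΦ.ext_on w.2 w'.2 fun b hb => ?_
    exact congrArg Subtype.val (congrFun h ⟨b, hb⟩)
  have : Finite (reflGroup Φ) := Finite.of_injective _ hinj
  exact Set.toFinite _

theorem ne_or_of_inner {a b : E} (ha : a ∈ Φ) (hb : b ∈ Φ) (h1 : b ≠ a) (h2 : b ≠ -a) :
    b - ⟪b, a⟫ • a ≠ 0 := by
  intro h
  rcases eq_or_eq_neg_of_eq_smul (hΦ.norm_one a ha) (hΦ.norm_one b hb) (sub_eq_zero.1 h)
    with h | h
  · exact h1 h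
  · exact h2 h

theorem exists_regular : ∃ x, Regular Φ x := by
  obtain ⟨x, hx⟩ := exists_forall_inner_ne_zero (fun b : Φ => b.1) fun b => hΦ.ne_zero b.2
  exact ⟨x, fun b hb => hx ⟨b, hb⟩⟩

end IsUnitSystem

/-- `a ∈ Φ` is a simple root for the chamber of `x`: it is positive at `x` and its hyperplane is
a wall, with `y` in the interior of the face. -/
def IsSimple (Φ : Finset E) (x a : E) : Prop :=
  a ∈ Φ ∧ 0 < ⟪a, x⟫ ∧ ∃ y, ⟪a, y⟫ = 0 ∧ ∀ b ∈ Φ, b ≠ a → b ≠ -a → 0 < ⟪b, x⟫ * ⟪b, y⟫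

/-- The group generated by the simple reflections of the chamber of `x`. -/
def simpleGroup (Φ : Finset E) (x : E) : Subgroup (E ≃ₗᵢ[ℝ] E) :=
  Subgroup.closure (refl '' {a | IsSimple Φ x a})

namespace IsUnitSystem

variable {Φ : Finset E} (hΦ : IsUnitSystem Φ)
include hΦ

omit hΦ in
theorem refl_ne {a b : E} (h1 : b ≠ a) (h2 : b ≠ -a) : refl a b ≠ a ∧ refl a b ≠ -a := by
  constructor
  · intro h
    apply h2
    rw [← refl_refl a b, h, refl_self]
  · intro h
    apply h1
    rw [← refl_refl a b, h, map_neg, refl_self, neg_neg]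

theorem simple_pos {x a b : E} (ha : IsSimple Φ x a) (hb : b ∈ Φ) (h1 : b ≠ a) (h2 : b ≠ -a) :
    0 < ⟪b, x⟫ * ⟪refl a b, x⟫ := by
  obtain ⟨haΦ, -, y, hy, hall⟩ := ha
  have hn := refl_ne h1 h2
  have e1 := hall b hb h1 h2
  have e2 := hall _ (hΦ.refl_mem a haΦ b hb) hn.1 hn.2
  rw [inner_refl_left a b y, refl_of_inner_eq_zero (hΦ.norm_one a haΦ) hy] at e2
  have := mul_pos e1 e2
  have h3 := sq_pos_of_ne_zero (right_ne_zero_of_mul e1.ne')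
  by_contra! h4
  nlinarith

/-- If `z` lies outside the chamber of `x`, then some simple root of that chamber is negative
at `z`. -/
theorem exists_simple {x z : E} (hx : Regular Φ x) (hz : Regular Φ z)
    (h : ∃ b ∈ Φ, ⟪b, x⟫ * ⟪b, z⟫ < 0) : ∃ a, IsSimple Φ x a ∧ ⟪a, z⟫ < 0 := by
  obtain ⟨i, hi, his, x', y, hy, hall⟩ := exists_separating_wall (S := (Φ : Set E))
    Φ.finite_toSet (fun b => innerₗ E b) (x := x) (z := z) hx hz h
  simp only [innerₗ_apply_apply, Finset.mem_coe] at *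
  have key : ∀ b ∈ Φ, b ≠ i → b ≠ -i → 0 < ⟪b, x⟫ * ⟪b, y⟫ := by
    intro b hb h1 h2
    refine ((hall b hb).2 fun hm => ?_).1
    rcases (innerₗ_mem_span_singleton (hΦ.norm_one i hi) (hΦ.norm_one b hb)).1 hm with h | h
    exacts [h1 h, h2 h]
  rcases mul_neg_iff.1 his with ⟨h1, h2⟩ | ⟨h1, h2⟩
  · exact ⟨i, ⟨hi, h1, y, hy, key⟩, h2⟩
  · refine ⟨-i, ⟨hΦ.neg_mem hi, by simpa using h1, y, by simpa using hy, ?_⟩, by simpa using h2⟩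
    intro b hb h1 h2
    exact key b hb (by simpa using h2) h1

theorem exists_isSimple {x : E} (hx : Regular Φ x) (hne : Φ.Nonempty) : ∃ a, IsSimple Φ x a := by
  obtain ⟨b, hb⟩ := hne
  obtain ⟨a, ha, -⟩ := hΦ.exists_simple (z := -x) hx (fun c hc => by simpa using hx c hc)
    ⟨b, hb, by
      have := sq_pos_of_ne_zero (hx b hb)
      rw [inner_neg_right]
      nlinarith⟩
  exact ⟨a, ha⟩

theorem regular_apply {x : E} (hx : Regular Φ x) {w : E ≃ₗᵢ[ℝ] E} (hw : w ∈ reflGroup Φ) :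
    Regular Φ (w x) := by
  intro b hb
  rw [← inner_inv_left]
  exact hx _ (hΦ.apply_mem (inv_mem hw) b hb)

omit hΦ in
theorem simpleGroup_le (x : E) : simpleGroup Φ x ≤ reflGroup Φ :=
  Subgroup.closure_mono (Set.image_mono fun _ ha => ha.1)

/-- The simple reflections of a chamber move every regular vector into that chamber: reflecting
in a simple root which is negative at `z` lowers the number of separating hyperplanes. -/
theorem exists_mem_simpleGroup {x : E} (hx : Regular Φ x) : ∀ {z : E}, Regular Φ z →
    ∃ u ∈ simpleGroup Φ x, ∀ b ∈ Φ, 0 < ⟪b, x⟫ * ⟪b, u z⟫ := by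
  classical
  suffices H : ∀ n : ℕ, ∀ z : E, Regular Φ z →
      (Φ.filter fun b => ⟪b, x⟫ * ⟪b, z⟫ < 0).card = n →
      ∃ u ∈ simpleGroup Φ x, ∀ b ∈ Φ, 0 < ⟪b, x⟫ * ⟪b, u z⟫ from
    fun {z} hz => H _ z hz rfl
  intro n
  induction n using Nat.strong_induction_on with
  | _ n ih =>
    intro z hz hn
    by_cases h : ∃ b ∈ Φ, ⟪b, x⟫ * ⟪b, z⟫ < 0
    · obtain ⟨a, ha, haz⟩ := hΦ.exists_simple hx hz h
      have hlt : (Φ.filter fun b => ⟪b, x⟫ * ⟪b, refl a z⟫ < 0).card < n := by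
        rw [← hn]
        refine lt_of_le_of_lt (b := ((Φ.filter fun b => ⟪b, x⟫ * ⟪b, z⟫ < 0).erase a).card)
          ?_ (Finset.card_erase_lt_of_mem ?_)
        · refine Finset.card_le_card_of_injOn (refl a) ?_ (refl a).injective.injOn
          intro b hb
          rw [Finset.mem_coe, Finset.mem_filter] at hb
          obtain ⟨hb, hs⟩ := hb
          rw [← inner_refl_left] at hs
          have h1 : b ≠ a := by
            rintro rfl
            rw [refl_self, inner_neg_left] at hs
            nlinarith [mul_pos ha.2.1 (neg_pos.2 haz)]
          have h2 : b ≠ -a := by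
            rintro rfl
            rw [map_neg, refl_self, inner_neg_left, inner_neg_left, inner_neg_left] at hs
            nlinarith [mul_pos ha.2.1 (neg_pos.2 haz)]
          rw [Finset.mem_coe, Finset.mem_erase, Finset.mem_filter]
          refine ⟨(refl_ne h1 h2).1, hΦ.refl_mem a ha.1 b hb, ?_⟩
          have := mul_neg_of_pos_of_neg (hΦ.simple_pos ha hb h1 h2) hs
          have h3 := sq_pos_of_ne_zero (hx b hb)
          by_contra! h4
          nlinarith
        · rw [Finset.mem_filter]
          exact ⟨ha.1, mul_neg_of_pos_of_neg ha.2.1 haz⟩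
      obtain ⟨u, hu, hu'⟩ := ih _ hlt (refl a z)
        (hΦ.regular_apply hz (refl_mem_reflGroup ha.1)) rfl
      exact ⟨u * refl a, mul_mem hu (Subgroup.subset_closure ⟨a, ha, rfl⟩), hu'⟩
    · push Not at h
      refine ⟨1, one_mem _, fun b hb => ?_⟩
      exact lt_of_le_of_ne (h b hb) (mul_ne_zero (hx b hb) (hz b hb)).symm

/-- Every root is simple for some chamber. -/
theorem exists_isSimple_of_mem {a : E} (ha : a ∈ Φ) : ∃ z, Regular Φ z ∧ IsSimple Φ z a := by
  classical
  have : Finite {b // b ∈ Φ ∧ b ≠ a ∧ b ≠ -a} :=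
    (Φ.finite_toSet.subset fun b hb => hb.1 : {b | b ∈ Φ ∧ b ≠ a ∧ b ≠ -a}.Finite).to_subtype
  obtain ⟨p, hp⟩ := exists_forall_inner_ne_zero
    (fun b : {b // b ∈ Φ ∧ b ≠ a ∧ b ≠ -a} => b.1 - ⟪b.1, a⟫ • a)
    fun b => hΦ.ne_or_of_inner ha b.2.1 b.2.2.1 b.2.2.2
  set y := p - ⟪a, p⟫ • a with hy
  have hay : ⟪a, y⟫ = 0 := by simp [hy, inner_sub_right, inner_smul_right, hΦ.norm_one a ha]
  have hby : ∀ b ∈ Φ, b ≠ a → b ≠ -a → ⟪b, y⟫ ≠ 0 := by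
    intro b hb h1 h2
    have := hp ⟨b, hb, h1, h2⟩
    simp only [inner_sub_left, inner_smul_left] at this
    simpa [hy, inner_sub_right, inner_smul_right, mul_comm] using this
  have h3 : ∀ᶠ t : ℝ in 𝓝[>] 0, ∀ b ∈ Φ, b ≠ a → b ≠ -a →
      0 < ⟪b, y⟫ * (⟪b, y⟫ + t * ⟪b, a⟫) := by
    refine (Filter.eventually_all_finset Φ).2 fun b hb => ?_
    by_cases h : b ≠ a ∧ b ≠ -a
    · filter_upwards [eventually_pos_mul_add_mul (hby b hb h.1 h.2) ⟪b, a⟫] with t ht _ _ using ht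
    · exact Eventually.of_forall fun _ h1 h2 => absurd ⟨h1, h2⟩ h
  obtain ⟨t, ht, ht0⟩ := (h3.and self_mem_nhdsWithin).exists
  have ht0 : 0 < t := ht0
  have haz : ⟪a, y + t • a⟫ = t := by simp [inner_add_right, inner_smul_right, hΦ.norm_one a ha, hay]
  have hbz : ∀ b ∈ Φ, b ≠ a → b ≠ -a → 0 < ⟪b, y + t • a⟫ * ⟪b, y⟫ := by
    intro b hb h1 h2
    rw [inner_add_right, inner_smul_right, mul_comm]
    exact ht b hb h1 h2
  refine ⟨y + t • a, fun b hb => ?_, ha, by rw [haz]; exact ht0, y, hay, hbz⟩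
  by_cases h1 : b = a
  · rw [h1, haz]; exact ht0.ne'
  by_cases h2 : b = -a
  · rw [h2, inner_neg_left, haz]; exact (neg_lt_zero.2 ht0).ne
  exact left_ne_zero_of_mul (hbz b hb h1 h2).ne'

theorem simpleGroup_eq {x : E} (hx : Regular Φ x) : simpleGroup Φ x = reflGroup Φ := by
  refine le_antisymm (simpleGroup_le x) ?_
  rw [reflGroup, Subgroup.closure_le]
  rintro _ ⟨a, ha, rfl⟩
  obtain ⟨z, hz, -, haz, y, hay, hall⟩ := hΦ.exists_isSimple_of_mem ha
  obtain ⟨u, hu, hu'⟩ := hΦ.exists_mem_simpleGroup hx hz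
  have huW := simpleGroup_le x hu
  have hua : u a ∈ Φ := hΦ.apply_mem huW a ha
  have hsim : IsSimple Φ x (u a) := by
    refine ⟨hua, ?_, u y, ?_, ?_⟩
    · have := hu' _ hua
      rw [LinearIsometryEquiv.inner_map_map] at this
      exact (pos_iff_pos_of_mul_pos this).2 haz
    · rw [LinearIsometryEquiv.inner_map_map, hay]
    · intro b hb h1 h2
      have hub : u (u⁻¹ b) = b := u.apply_symm_apply b
      have e1 := hall (u⁻¹ b) (hΦ.apply_mem (inv_mem huW) b hb)
        (fun h => h1 (by rw [← h, hub])) (fun h => h2 (by rw [← map_neg, ← h, hub]))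
      rw [inner_inv_left, inner_inv_left] at e1
      have e2 := hu' b hb
      have := mul_pos e1 e2
      have h3 := sq_pos_of_ne_zero (left_ne_zero_of_mul e1.ne')
      by_contra! h4
      nlinarith
  have hconj := mul_refl_mul_inv u (hΦ.norm_one a ha)
  have : refl a = u⁻¹ * refl (u a) * u := by rw [← hconj]; group
  rw [this]
  exact mul_mem (mul_mem (inv_mem hu) (Subgroup.subset_closure ⟨_, hsim, rfl⟩)) hu

end IsUnitSystem

/-! ### Stabilizers -/

theorem exists_list_of_mem_simpleGroup {Φ : Finset E} {x : E} {w : E ≃ₗᵢ[ℝ] E}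
    (hw : w ∈ simpleGroup Φ x) :
    ∃ l : List E, (∀ a ∈ l, IsSimple Φ x a) ∧ (l.map refl).prod = w := by
  refine Subgroup.closure_induction_left (p := fun w _ => ∃ l : List E,
    (∀ a ∈ l, IsSimple Φ x a) ∧ (l.map refl).prod = w) ⟨[], by simp, rfl⟩ ?_ ?_ hw
  · rintro _ ⟨a, ha, rfl⟩ w _ ⟨l, hl, rfl⟩
    exact ⟨a :: l, by simpa using ⟨ha, hl⟩, by simp⟩
  · rintro _ ⟨a, ha, rfl⟩ w _ ⟨l, hl, rfl⟩
    exact ⟨a :: l, by simpa using ⟨ha, hl⟩, by simp [refl_inv]⟩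

namespace IsUnitSystem

variable {Φ : Finset E} (hΦ : IsUnitSystem Φ)
include hΦ

/-- The exchange condition. -/
theorem exchange {x : E} (hx : Regular Φ x) {a : E} (ha : IsSimple Φ x a) :
    ∀ l : List E, (∀ b ∈ l, IsSimple Φ x b) → ⟪(l.map refl).prod a, x⟫ < 0 →
      ∃ l' : List E, (∀ b ∈ l', IsSimple Φ x b) ∧ l'.length + 1 = l.length ∧
        (l'.map refl).prod = (l.map refl).prod * refl a
  | [], _, h => by
    have : ⟪a, x⟫ < 0 := h
    exact absurd ha.2.1 this.not_gt
  | b :: l, hl, h => by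
    have hb : IsSimple Φ x b := hl b (by simp)
    have hl1 : ∀ c ∈ l, IsSimple Φ x c := fun c hc => hl c (by simp [hc])
    set w := (l.map refl).prod with hw
    have hwW : w ∈ reflGroup Φ := Subgroup.list_prod_mem _ fun u hu => by
      obtain ⟨c, hc, rfl⟩ := List.mem_map.1 hu
      exact refl_mem_reflGroup (hl1 c hc).1
    have hwa : w a ∈ Φ := hΦ.apply_mem hwW a ha.1
    have h : ⟪refl b (w a), x⟫ < 0 := by
      rw [List.map_cons, List.prod_cons] at h
      exact h
    rcases lt_or_gt_of_ne (hx _ hwa) with hneg | hpos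
    · obtain ⟨l', h1, h2, h3⟩ := exchange hx ha l hl1 hneg
      refine ⟨b :: l', by simpa using ⟨hb, h1⟩, by simp [h2], ?_⟩
      rw [List.map_cons, List.prod_cons, List.map_cons, List.prod_cons, h3, mul_assoc]
    · have hab : w a = b := by
        by_contra h1
        have h2 : w a ≠ -b := by
          intro h2
          rw [h2, inner_neg_left] at hpos
          linarith [hb.2.1]
        have := hΦ.simple_pos hb hwa h1 h2
        nlinarith
      refine ⟨l, hl1, by simp, ?_⟩
      rw [List.map_cons, List.prod_cons, ← hw, ← hab, ← mul_refl_mul_inv w (hΦ.norm_one a ha.1)]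
      have : w * refl a * w⁻¹ * w * refl a = w * (refl a * refl a) := by group
      rw [this, refl_mul_self, mul_one]

/-- The reflection group acts freely on chambers. -/
theorem eq_one_of_forall_pos {x : E} (hx : Regular Φ x) {w : E ≃ₗᵢ[ℝ] E} (hw : w ∈ reflGroup Φ)
    (hpos : ∀ b ∈ Φ, 0 < ⟪b, x⟫ → 0 < ⟪w b, x⟫) : w = 1 := by
  suffices H : ∀ n : ℕ, ∀ l : List E, l.length = n → (∀ b ∈ l, IsSimple Φ x b) →
      (∀ b ∈ Φ, 0 < ⟪b, x⟫ → 0 < ⟪(l.map refl).prod b, x⟫) → (l.map refl).prod = 1 by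
    rw [← hΦ.simpleGroup_eq hx] at hw
    obtain ⟨l, hl, rfl⟩ := exists_list_of_mem_simpleGroup hw
    exact H _ l rfl hl hpos
  intro n
  induction n using Nat.strong_induction_on with
  | _ n ih =>
    intro l hn hl hpos
    rcases l.eq_nil_or_concat with rfl | ⟨l₀, a, rfl⟩
    · rfl
    · rw [List.concat_eq_append] at *
      have ha : IsSimple Φ x a := hl a (by simp)
      have e : ((l₀ ++ [a]).map refl).prod = (l₀.map refl).prod * refl a := by simp
      rw [e] at hpos ⊢
      have h1 : ⟪(l₀.map refl).prod a, x⟫ < 0 := by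
        have h2 := hpos a ha.1 ha.2.1
        have h3 : ((l₀.map refl).prod * refl a) a = (l₀.map refl).prod (refl a a) := rfl
        rw [h3, refl_self, map_neg, inner_neg_left] at h2
        linarith
      obtain ⟨l', h2, h3, h4⟩ := hΦ.exchange hx ha l₀ (fun b hb => hl b (by simp [hb])) h1
      rw [← h4] at hpos ⊢
      refine ih l'.length ?_ l' rfl h2 hpos
      rw [← hn, List.length_append]
      omega

/-- The stabilizer of a vector is generated by the reflections in the roots orthogonal to it. -/
theorem mem_reflGroup_perp {w : E ≃ₗᵢ[ℝ] E} (hw : w ∈ reflGroup Φ) {v : E} (hv : w v = v) :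
    w ∈ reflGroup (StableConstants.perp Φ v) := by
  have hsub : StableConstants.perp Φ v ⊆ Φ := fun b hb => (mem_perp.1 hb).1
  have hΨ := hΦ.perp v
  obtain ⟨z, hz⟩ := hΦ.exists_regular
  have h1 : ∀ᶠ t : ℝ in 𝓝[>] 0, ∀ b ∈ Φ, ⟪b, v⟫ ≠ 0 →
      0 < ⟪b, v⟫ * (⟪b, v⟫ + t * ⟪b, z⟫) ∧ 0 < ⟪b, v⟫ * (⟪b, v⟫ + t * ⟪b, w z⟫) := by
    refine (Filter.eventually_all_finset Φ).2 fun b _ => ?_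
    by_cases h : ⟪b, v⟫ ≠ 0
    · filter_upwards [eventually_pos_mul_add_mul h ⟪b, z⟫,
        eventually_pos_mul_add_mul h ⟪b, w z⟫] with t h1 h2 _ using ⟨h1, h2⟩
    · exact Eventually.of_forall fun _ h' => absurd h' h
  obtain ⟨t, ht, ht0⟩ := (h1.and self_mem_nhdsWithin).exists
  have ht0 : 0 < t := ht0
  -- a regular vector `x` close to `v`
  set x := v + t • z with hx
  have hwx : w x = v + t • w z := by rw [hx, map_add, map_smul, hv]
  have hbx : ∀ b ∈ Φ, ⟪b, v⟫ ≠ 0 → 0 < ⟪b, v⟫ * ⟪b, x⟫ := fun b hb h => by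
    simpa [hx, inner_add_right, inner_smul_right] using (ht b hb h).1
  have hbwx : ∀ b ∈ Φ, ⟪b, v⟫ ≠ 0 → 0 < ⟪b, v⟫ * ⟪b, w x⟫ := fun b hb h => by
    simpa [hwx, inner_add_right, inner_smul_right] using (ht b hb h).2
  have hxreg : Regular Φ x := by
    intro b hb
    by_cases h : ⟪b, v⟫ = 0
    · simp [hx, inner_add_right, inner_smul_right, h, ht0.ne', hz b hb]
    · exact right_ne_zero_of_mul (hbx b hb h).ne'
  have hwxreg := hΦ.regular_apply hxreg hw
  obtain ⟨u, hu, hu'⟩ := hΨ.exists_mem_simpleGroup (x := x) (z := w x)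
    (fun b hb => hxreg b (hsub hb)) (fun b hb => hwxreg b (hsub hb))
  have huΨ : u ∈ reflGroup (StableConstants.perp Φ v) := simpleGroup_le x hu
  have huΦ : u ∈ reflGroup Φ := reflGroup_le hsub huΨ
  have huv : u v = v := hΨ.apply_eq_self huΨ fun b hb => (mem_perp.1 hb).2
  -- `u * w` preserves the chamber of `x`
  have hall : ∀ b ∈ Φ, 0 < ⟪b, x⟫ * ⟪b, u (w x)⟫ := by
    intro b hb
    by_cases h : ⟪b, v⟫ = 0
    · exact hu' b (mem_perp.2 ⟨hb, h⟩)
    · have e1 := hbx b hb h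
      have hc : ⟪u⁻¹ b, v⟫ = ⟪b, v⟫ := by rw [inner_inv_left, huv]
      have e2 := hbwx (u⁻¹ b) (hΦ.apply_mem (inv_mem huΦ) b hb) (by rwa [hc])
      rw [hc, inner_inv_left] at e2
      have := mul_pos e1 e2
      have h3 := sq_pos_of_ne_zero h
      by_contra! h4
      nlinarith
  have hone : (u * w)⁻¹ = 1 := by
    refine hΦ.eq_one_of_forall_pos hxreg (inv_mem (mul_mem huΦ hw)) fun b hb hpos => ?_
    rw [inner_inv_left]
    exact (pos_iff_pos_of_mul_pos (hall b hb)).1 hpos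
  rw [inv_eq_one] at hone
  rw [eq_inv_of_mul_eq_one_right hone]
  exact inv_mem huΨ

end IsUnitSystem

/-- The reflection group contains an element which acts as `-1` on `Φ`. -/
def HasNeg (Φ : Finset E) : Prop := ∃ w ∈ reflGroup Φ, ∀ b ∈ Φ, w b = -b

namespace IsUnitSystem

variable {Φ : Finset E} (hΦ : IsUnitSystem Φ)
include hΦ

theorem exists_neg_perp (hn : HasNeg Φ) {a : E} (ha : a ∈ Φ) :
    ∃ w ∈ reflGroup (StableConstants.perp Φ a),
      ∀ x ∈ Submodule.span ℝ (Φ : Set E), ⟪x, a⟫ = 0 → w x = -x := by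
  obtain ⟨w, hw, hneg⟩ := hn
  refine ⟨w * refl a, hΦ.mem_reflGroup_perp (mul_mem hw (refl_mem_reflGroup ha)) ?_, ?_⟩
  · have : (w * refl a) a = w (refl a a) := rfl
    rw [this, refl_self, map_neg, hneg a ha, neg_neg]
  · intro x hx hxa
    have : (w * refl a) x = w (refl a x) := rfl
    rw [this, refl_of_inner_eq_zero (hΦ.norm_one a ha) (by rwa [real_inner_comm])]
    have h : Set.EqOn w.toLinearEquiv.toLinearMap (-LinearMap.id : E →ₗ[ℝ] E) (Φ : Set E) :=
      fun b hb => hneg b hb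
    exact LinearMap.eqOn_span h hx

theorem hasNeg_perp (hn : HasNeg Φ) {a : E} (ha : a ∈ Φ) : HasNeg (StableConstants.perp Φ a) := by
  obtain ⟨w, hw, h⟩ := hΦ.exists_neg_perp hn ha
  refine ⟨w, hw, fun b hb => h b (Submodule.subset_span (mem_perp.1 hb).1) (mem_perp.1 hb).2⟩

/-- When `-1` belongs to the reflection group, the roots orthogonal to a root `a` span the
orthogonal complement of `a` in the span of all roots. -/
theorem mem_span_perp (hn : HasNeg Φ) {a : E} (ha : a ∈ Φ) {x : E}
    (hx : x ∈ Submodule.span ℝ (Φ : Set E)) (hxa : ⟪x, a⟫ = 0) :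
    x ∈ Submodule.span ℝ (StableConstants.perp Φ a : Set E) := by
  obtain ⟨w, hw, h⟩ := hΦ.exists_neg_perp hn ha
  have := (hΦ.perp a).sub_mem_span hw x
  rw [h x hx hxa] at this
  have h2 : x = (-1 / 2 : ℝ) • (-x - x) := by module
  rw [h2]
  exact Submodule.smul_mem _ _ this

/-- A nontrivial involution of the reflection group negates some root. -/
theorem exists_apply_eq_neg {σ : E ≃ₗᵢ[ℝ] E} (hσ : σ ∈ reflGroup Φ) (h2 : σ * σ = 1)
    (h1 : σ ≠ 1) : ∃ a ∈ Φ, σ a = -a := by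
  by_contra! h
  have hσσ : ∀ x, σ (σ x) = x := fun x => congrArg (fun u : E ≃ₗᵢ[ℝ] E => u x) h2
  -- a generic fixed vector is regular, so that its stabilizer is trivial
  obtain ⟨p, hp⟩ := exists_forall_inner_ne_zero (fun b : Φ => b.1 + σ b.1)
    fun b h0 => h b.1 b.2 (eq_neg_of_add_eq_zero_right h0)
  have hinv : σ⁻¹ = σ := inv_eq_of_mul_eq_one_right h2
  have hfix : σ (p + σ p) = p + σ p := by rw [map_add, hσσ, add_comm]
  have hmem := hΦ.mem_reflGroup_perp hσ hfix
  have hempty : StableConstants.perp Φ (p + σ p) = ∅ := by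
    rw [Finset.eq_empty_iff_forall_notMem]
    intro b hb
    rw [mem_perp, inner_add_right, ← inner_inv_left, hinv, ← inner_add_left] at hb
    exact hp ⟨b, hb.1⟩ hb.2
  rw [hempty] at hmem
  apply h1
  simpa [reflGroup] using hmem

end IsUnitSystem

/-! ### The explicit formula and the wall-crossing rule -/

/-- The sign of a real number, as a complex number. -/
def sg (r : ℝ) : ℂ := (SignType.sign r : ℂ)

theorem sg_mul (r s : ℝ) : sg (r * s) = sg r * sg s := by
  simp [sg, sign_mul]

theorem sg_of_pos {r : ℝ} (h : 0 < r) : sg r = 1 := by simp [sg, sign_pos h]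

theorem sg_of_neg {r : ℝ} (h : r < 0) : sg r = -1 := by simp [sg, sign_neg h]

theorem sg_mul_self {r : ℝ} (h : r ≠ 0) : sg r * sg r = 1 := by
  rw [← sg_mul, sg_of_pos (mul_self_pos.2 h)]

theorem sg_eq_of_mul_pos {r s : ℝ} (h : 0 < r * s) : sg r = sg s := by
  have h1 := sg_of_pos h
  have h2 := sg_mul_self (right_ne_zero_of_mul h.ne')
  rw [sg_mul] at h1
  linear_combination sg s * h1 - sg r * h2

/-- The members of `Φ` which are positive at `L`. -/
def pos (Φ : Finset E) (L : E) : Finset E :=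
  open Classical in Φ.filter fun b => 0 < ⟪b, L⟫

theorem mem_pos {Φ : Finset E} {L b : E} : b ∈ pos Φ L ↔ b ∈ Φ ∧ 0 < ⟪b, L⟫ := by
  simp [pos]

/-- The involutions, including `1`, of the reflection group of `Φ`. -/
def invols (Φ : Finset E) : Finset (E ≃ₗᵢ[ℝ] E) :=
  open Classical in
  if h : {σ | σ ∈ reflGroup Φ ∧ σ * σ = 1}.Finite then h.toFinset else ∅

theorem IsUnitSystem.mem_invols {Φ : Finset E} (hΦ : IsUnitSystem Φ) {σ : E ≃ₗᵢ[ℝ] E} :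
    σ ∈ invols Φ ↔ σ ∈ reflGroup Φ ∧ σ * σ = 1 := by
  have h : {σ | σ ∈ reflGroup Φ ∧ σ * σ = 1}.Finite := hΦ.finite_reflGroup.subset fun _ h => h.1
  rw [invols, dif_pos h, Set.Finite.mem_toFinset, Set.mem_ofPred_eq]

/-- The space of vectors in the span of `Φ` which are fixed by `σ`. -/
def fixSpace (Φ : Finset E) (σ : E ≃ₗᵢ[ℝ] E) : Submodule ℝ E :=
  Submodule.span ℝ (Φ : Set E) ⊓ LinearMap.eqLocus σ.toLinearEquiv.toLinearMap LinearMap.id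

theorem mem_fixSpace {Φ : Finset E} {σ : E ≃ₗᵢ[ℝ] E} {x : E} :
    x ∈ fixSpace Φ σ ↔ x ∈ Submodule.span ℝ (Φ : Set E) ∧ σ x = x :=
  Iff.rfl

/-- The contribution of the pair of roots `±b` to the summand of an involution `σ`. It is even
in `b`; for `b` positive at `L` the sign is that of `b` at `x`. -/
def factor (σ : E ≃ₗᵢ[ℝ] E) (L x b : E) : ℂ :=
  open Classical in
  if σ b = -b then 1
  else sg (⟪b, L⟫ * ⟪b, x⟫) * if ⟪σ b, L⟫ * ⟪b, L⟫ < 0 ∨ σ b = b then Complex.I else 1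

/-- The summand of the involution `σ` in the formula for the stable constants. -/
def summand (Φ : Finset E) (L x : E) (σ : E ≃ₗᵢ[ℝ] E) : ℂ :=
  Complex.I ^ finrank ℝ (fixSpace Φ σ) * ∏ b ∈ pos Φ L, factor σ L x b

/-- The stable discrete series constant of the chambers of `x` and `L`, as a sum over the
involutions of the reflection group. It is defined for every unit system, but has this meaning
only when `-1` belongs to the group; the powers of the imaginary unit then combine to signs. -/
def formula (Φ : Finset E) (L x : E) : ℂ := ∑ σ ∈ invols Φ, summand Φ L x σ

theorem factor_neg (σ : E ≃ₗᵢ[ℝ] E) (L x b : E) : factor σ L x (-b) = factor σ L x b := by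
  have h1 : (σ (-b) = - -b) = (σ b = -b) := by rw [map_neg, neg_inj]
  have h2 : (σ (-b) = -b) = (σ b = b) := by rw [map_neg, neg_inj]
  have h3 : ⟪σ (-b), L⟫ * ⟪-b, L⟫ = ⟪σ b, L⟫ * ⟪b, L⟫ := by simp
  have h4 : ⟪-b, L⟫ * ⟪-b, x⟫ = ⟪b, L⟫ * ⟪b, x⟫ := by simp
  unfold factor
  rw [h1, h2, h3, h4]

theorem factor_congr (σ : E ≃ₗᵢ[ℝ] E) (L : E) {x y b : E} (h : 0 < ⟪b, x⟫ * ⟪b, y⟫) :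
    factor σ L x b = factor σ L y b := by
  simp only [factor, sg_mul, sg_eq_of_mul_pos h]

theorem factor_congr_left {σ τ : E ≃ₗᵢ[ℝ] E} (L x : E) {b : E} (h : σ b = τ b) :
    factor σ L x b = factor τ L x b := by
  unfold factor
  rw [h]

/-- The product of an even function over the roots positive at `L` does not depend on `L`. -/
theorem prod_pos_eq {B : Finset E} (hB : ∀ b ∈ B, -b ∈ B) {h : E → ℂ}
    (hh : ∀ b ∈ B, h (-b) = h b) {L L' : E} (hL : Regular B L) (hL' : Regular B L') :
    ∏ b ∈ pos B L, h b = ∏ b ∈ pos B L', h b := by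
  classical
  have hmem : ∀ {M M' : E}, Regular B M' → ∀ b ∈ pos B M,
      (if 0 < ⟪b, M'⟫ then b else -b) ∈ pos B M' := by
    intro M M' hM' b hb
    rw [mem_pos] at hb
    split_ifs with h
    · exact mem_pos.2 ⟨hb.1, h⟩
    · refine mem_pos.2 ⟨hB b hb.1, ?_⟩
      rw [inner_neg_left]
      exact neg_pos.2 (lt_of_le_of_ne (not_lt.1 h) (hM' b hb.1))
  have hinv : ∀ {M M' : E}, ∀ b ∈ pos B M,
      (if 0 < ⟪(if 0 < ⟪b, M'⟫ then b else -b), M⟫ then (if 0 < ⟪b, M'⟫ then b else -b)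
        else -(if 0 < ⟪b, M'⟫ then b else -b)) = b := by
    intro M M' b hb
    have hb' := (mem_pos.1 hb).2
    by_cases h : 0 < ⟪b, M'⟫
    · simp [h, hb']
    · simp [h, hb'.le]
  refine Finset.prod_bij' (fun b _ => if 0 < ⟪b, L'⟫ then b else -b)
    (fun b _ => if 0 < ⟪b, L⟫ then b else -b) (hmem hL') (hmem hL) hinv hinv ?_
  intro b hb
  split_ifs
  · rfl
  · exact (hh b (mem_pos.1 hb).1).symm

theorem ite_I_mul_ite_I {p q : ℝ} (hp : p ≠ 0) (hq : q ≠ 0) :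
    (if q * p < 0 then Complex.I else 1) * (if p * q < 0 then Complex.I else 1) = sg (p * q) := by
  rw [mul_comm q p]
  split_ifs with h
  · rw [Complex.I_mul_I, sg_of_neg h]
  · rw [sg_of_pos (lt_of_le_of_ne (not_lt.1 h) (mul_ne_zero hp hq).symm), mul_one]

theorem factor_mul_factor_apply {σ : E ≃ₗᵢ[ℝ] E} (hσσ : ∀ x, σ (σ x) = x) {L x b : E}
    (h1 : σ b ≠ b) (h2 : σ b ≠ -b) (hb : ⟪b, L⟫ ≠ 0) (hσb : ⟪σ b, L⟫ ≠ 0) :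
    factor σ L x b * factor σ L x (σ b) = sg (⟪b, x⟫ * ⟪σ b, x⟫) := by
  have h3 : σ (σ b) ≠ -σ b := by
    rw [hσσ]
    exact fun h => h2 (neg_eq_iff_eq_neg.1 h.symm)
  have h4 : σ (σ b) ≠ σ b := by rw [hσσ]; exact h1.symm
  simp only [factor, if_neg h2, if_neg h3, h1, h4, or_false]
  rw [hσσ]
  have e := ite_I_mul_ite_I hb hσb
  have e1 := sg_mul_self hb
  have e2 := sg_mul_self hσb
  simp only [sg_mul] at *
  calc _ = (sg ⟪b, L⟫ * sg ⟪σ b, L⟫ * sg ⟪b, x⟫ * sg ⟪σ b, x⟫) *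
      ((if ⟪σ b, L⟫ * ⟪b, L⟫ < 0 then Complex.I else 1) *
        (if ⟪b, L⟫ * ⟪σ b, L⟫ < 0 then Complex.I else 1)) := by ring
    _ = (sg ⟪b, L⟫ * sg ⟪b, L⟫) * (sg ⟪σ b, L⟫ * sg ⟪σ b, L⟫) *
        (sg ⟪b, x⟫ * sg ⟪σ b, x⟫) := by rw [e]; ring
    _ = _ := by rw [e1, e2]; ring

namespace IsUnitSystem

variable {Φ : Finset E} (hΦ : IsUnitSystem Φ)
include hΦ

/-- If the involution `σ` negates the root `a`, the roots which are neither proportional nor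
orthogonal to `a` contribute trivially on the hyperplane of `a`: these roots are permuted by the
group generated by `σ` and the reflection in `a`, and they cancel orbit by orbit. -/
theorem prod_factor_eq_one {σ : E ≃ₗᵢ[ℝ] E} (hσ : ∀ b ∈ Φ, σ b ∈ Φ) (hσσ : ∀ x, σ (σ x) = x)
    {a L y : E} (ha : a ∈ Φ) (hσa : σ a = -a) (hL : Regular Φ L) (hy : ⟪a, y⟫ = 0)
    (hreg : ∀ b ∈ Φ, b ≠ a → b ≠ -a → ⟪b, y⟫ ≠ 0) {M : Finset E}
    (hM : ∀ b, b ∈ M ↔ b ∈ Φ ∧ b ≠ a ∧ b ≠ -a ∧ ⟪b, a⟫ ≠ 0) :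
    ∏ b ∈ pos M L, factor σ L y b = 1 := by
  classical
  have ha1 := hΦ.norm_one a ha
  have hσi : ∀ u v : E, ⟪σ u, v⟫ = ⟪u, σ v⟫ := fun u v => by
    rw [← LinearIsometryEquiv.inner_map_map σ, hσσ]
  have hcomm : ∀ u, σ (refl a u) = refl a (σ u) := fun u => by
    rw [refl_apply ha1, refl_apply ha1, map_sub, map_smul, hσa, ← hσi, hσa, inner_neg_left]
    module
  have hsy : ∀ b, ⟪refl a b, y⟫ = ⟪b, y⟫ := fun b => by
    rw [inner_refl_left, refl_of_inner_eq_zero ha1 hy]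
  have hsa : ∀ b, ⟪refl a b, a⟫ = -⟪b, a⟫ := fun b => by
    rw [inner_refl_left, refl_self, inner_neg_right]
  have hσa' : ∀ b, ⟪σ b, a⟫ = -⟪b, a⟫ := fun b => by rw [hσi, hσa, inner_neg_right]
  have hsM : ∀ b ∈ Φ, refl a b ∈ Φ := fun b hb => hΦ.refl_mem a ha b hb
  -- evenness allows to select by positivity at `y`
  have hMΦ : ∀ b ∈ M, b ∈ Φ := fun b hb => ((hM b).1 hb).1
  rw [prod_pos_eq (L' := y) (h := factor σ L y) (fun b hb => ?_) (fun b _ => factor_neg σ L y b)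
    (fun b hb => hL b (hMΦ b hb))
    (fun b hb => hreg b (hMΦ b hb) ((hM b).1 hb).2.1 ((hM b).1 hb).2.2.1)]
  swap
  · rw [hM] at hb ⊢
    refine ⟨hΦ.neg_mem hb.1, fun h => hb.2.2.1 (by rw [← h, neg_neg]),
      fun h => hb.2.1 (neg_injective h), by simpa using hb.2.2.2⟩
  set K : Finset E := Φ.filter fun b => 0 < ⟪b, a⟫ ∧ 0 < ⟪b, y⟫ with hK
  have hne : ∀ {b : E}, ⟪b, y⟫ ≠ 0 → b ≠ a ∧ b ≠ -a := fun {b} hb =>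
    ⟨fun h => hb (by rw [h, hy]), fun h => hb (by rw [h, inner_neg_left, hy, neg_zero])⟩
  have hKne : ∀ {b : E}, b ∈ K → b ≠ a ∧ b ≠ -a := fun {b} hb =>
    hne (Finset.mem_filter.1 hb).2.2.ne'
  have hsplit : ∏ b ∈ pos M y, factor σ L y b
      = ∏ b ∈ K, factor σ L y b * factor σ L y (refl a b) := by
    rw [Finset.prod_mul_distrib, ← Finset.prod_filter_mul_prod_filter_not (pos M y)
      (fun b => 0 < ⟪b, a⟫)]
    congr 1
    · refine Finset.prod_congr ?_ fun _ _ => rfl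
      ext b
      simp only [Finset.mem_filter, mem_pos, hM, hK]
      constructor
      · rintro ⟨⟨h1, h2⟩, h3⟩
        exact ⟨h1.1, h3, h2⟩
      · rintro ⟨h1, h2, h3⟩
        exact ⟨⟨⟨h1, (hne h3.ne').1, (hne h3.ne').2, h2.ne'⟩, h3⟩, h2⟩
    · refine Finset.prod_nbij' (refl a) (refl a) ?_ ?_ (fun b _ => refl_refl a b)
        (fun b _ => refl_refl a b) (fun b _ => by rw [refl_refl])
      · intro b hb
        simp only [Finset.mem_filter, mem_pos, hM, hK] at hb ⊢
        refine ⟨hsM b hb.1.1.1, ?_, by rw [hsy]; exact hb.1.2⟩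
        rw [hsa]
        exact neg_pos.2 (lt_of_le_of_ne (not_lt.1 hb.2) hb.1.1.2.2.2)
      · intro b hb
        simp only [Finset.mem_filter, mem_pos, hM, hK] at hb ⊢
        have h3 : 0 < ⟪refl a b, y⟫ := by rw [hsy]; exact hb.2.2
        refine ⟨⟨⟨hsM b hb.1, (hne h3.ne').1, (hne h3.ne').2, ?_⟩, h3⟩, ?_⟩
        · rw [hsa]; exact (neg_neg_of_pos hb.2.1).ne
        · rw [hsa]; exact (neg_neg_of_pos hb.2.1).not_gt
  rw [hsplit]
  -- two roots exchanged by `σ` up to sign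
  have hpair : ∀ b ∈ Φ, ⟪b, a⟫ ≠ 0 → σ b ≠ -b →
      factor σ L y b * factor σ L y (σ b) = sg (⟪b, y⟫ * ⟪σ b, y⟫) := by
    intro b hb hba h
    refine factor_mul_factor_apply hσσ (fun h' => hba ?_) h (hL b hb) (hL _ (hσ b hb))
    have := hσa' b
    rw [h'] at this
    linarith
  have hcancel : ∀ b ∈ K, σ b ≠ -b → factor σ L y b * factor σ L y (refl a b) *
      (factor σ L y (σ (refl a b)) * factor σ L y (σ b)) = 1 := by
    intro b hb h
    rw [hK, Finset.mem_filter] at hb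
    have hsb : ⟪refl a b, a⟫ ≠ 0 := by rw [hsa]; exact (neg_neg_of_pos hb.2.1).ne
    have hsσ : σ (refl a b) ≠ -refl a b := by
      rw [hcomm, ← map_neg]
      exact fun h' => h ((refl a).injective h')
    have e1 := hpair b hb.1 hb.2.1.ne' h
    have e2 := hpair _ (hsM b hb.1) hsb hsσ
    rw [hcomm, hsy, hsy] at e2
    rw [hcomm]
    have hby := (hne hb.2.2.ne')
    have hσy : ⟪σ b, y⟫ ≠ 0 := by
      refine hreg _ (hσ b hb.1) (fun h' => hby.2 ?_) (fun h' => hby.1 ?_)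
      · rw [← hσσ b, h', hσa]
      · rw [← hσσ b, h', map_neg, hσa, neg_neg]
    have e3 := sg_mul_self (mul_ne_zero hb.2.2.ne' hσy)
    calc _ = (factor σ L y b * factor σ L y (σ b)) *
        (factor σ L y (refl a b) * factor σ L y (refl a (σ b))) := by ring
      _ = 1 := by rw [e1, e2, e3]
  have hone : ∀ b ∈ K, σ b = -b → factor σ L y b * factor σ L y (refl a b) = 1 := by
    intro b _ h
    have h' : σ (refl a b) = -refl a b := by rw [hcomm, h, map_neg]
    simp [factor, h, h']
  have hyσ : ∀ b ∈ K, ⟪σ b, y⟫ ≠ 0 := by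
    intro b hb
    have hby := hKne hb
    refine hreg _ (hσ b (Finset.mem_filter.1 hb).1) (fun h' => hby.2 ?_) (fun h' => hby.1 ?_)
    · rw [← hσσ b, h', hσa]
    · rw [← hσσ b, h', map_neg, hσa, neg_neg]
  have hτy : ∀ b, ⟪σ (refl a b), y⟫ = ⟪σ b, y⟫ := fun b => by rw [hcomm, hsy]
  have hτa : ∀ b, ⟪σ (refl a b), a⟫ = ⟪b, a⟫ := fun b => by rw [hσa', hsa, neg_neg]
  refine Finset.prod_involution
    (fun b _ => if 0 < ⟪σ b, y⟫ then σ (refl a b) else -σ b) ?_ ?_ ?_ ?_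
  · intro b hb
    by_cases h : σ b = -b
    · have hlt : ¬ 0 < ⟪σ b, y⟫ := by
        rw [h, inner_neg_left]
        have := (Finset.mem_filter.1 hb).2.2
        linarith
      simp only [if_neg hlt]
      rw [h, neg_neg, hone b hb h, mul_one]
    · have e := hcancel b hb h
      split_ifs with hs
      · rw [← hcomm (refl a b), refl_refl]
        exact e
      · rw [map_neg, factor_neg, factor_neg, ← hcomm, mul_comm (factor σ L y (σ b))]
        exact e
  · intro b hb hb1 hfix
    have h : σ b ≠ -b := fun h => hb1 (hone b hb h)
    split_ifs at hfix with hs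
    -- here `σ b = refl a b`
    · have hσb : σ b = refl a b := by rw [← hσσ (refl a b), hfix]
      apply hb1
      rw [← hσb, hpair b (Finset.mem_filter.1 hb).1 (Finset.mem_filter.1 hb).2.1.ne' h]
      exact sg_of_pos (mul_pos (Finset.mem_filter.1 hb).2.2 hs)
    · exact h (neg_eq_iff_eq_neg.1 hfix)
  · intro b hb
    have hb' := Finset.mem_filter.1 hb
    split_ifs with hs
    · refine Finset.mem_filter.2 ⟨hσ _ (hsM b hb'.1), ?_, ?_⟩
      · rw [hτa]; exact hb'.2.1
      · rw [hτy]; exact hs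
    · refine Finset.mem_filter.2 ⟨hΦ.neg_mem (hσ b hb'.1), ?_, ?_⟩
      · rw [inner_neg_left, hσa', neg_neg]; exact hb'.2.1
      · rw [inner_neg_left]
        exact neg_pos.2 (lt_of_le_of_ne (not_lt.1 hs) (hyσ b hb))
  · intro b hb
    have hb' := Finset.mem_filter.1 hb
    split_ifs with hs h2 h2
    · rw [← hcomm (refl a b), refl_refl, hσσ]
    · rw [hσσ, hsy] at h2
      exact absurd hb'.2.2 h2
    · rw [map_neg, hσσ, inner_neg_left] at h2
      linarith [hb'.2.2]
    · rw [map_neg, hσσ, neg_neg]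

end IsUnitSystem

/-- The members of `Φ` which are neither proportional nor orthogonal to `a`. -/
def oblique (Φ : Finset E) (a : E) : Finset E :=
  open Classical in Φ.filter fun b => b ≠ a ∧ b ≠ -a ∧ ⟪b, a⟫ ≠ 0

theorem mem_oblique {Φ : Finset E} {a b : E} :
    b ∈ oblique Φ a ↔ b ∈ Φ ∧ b ≠ a ∧ b ≠ -a ∧ ⟪b, a⟫ ≠ 0 := by
  simp [oblique]

theorem apply_apply_of_mul_self {σ : E ≃ₗᵢ[ℝ] E} (h : σ * σ = 1) (x : E) : σ (σ x) = x :=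
  congrArg (fun u : E ≃ₗᵢ[ℝ] E => u x) h

namespace IsUnitSystem

variable {Φ : Finset E} (hΦ : IsUnitSystem Φ)
include hΦ

theorem prod_pos_split {a L : E} (ha : a ∈ Φ) (haL : 0 < ⟪a, L⟫) (f : E → ℂ) :
    ∏ b ∈ pos Φ L, f b
      = f a * ((∏ b ∈ pos (StableConstants.perp Φ a) L, f b) * ∏ b ∈ pos (oblique Φ a) L, f b) := by
  classical
  rw [← Finset.mul_prod_erase (pos Φ L) f (mem_pos.2 ⟨ha, haL⟩),
    ← Finset.prod_filter_mul_prod_filter_not ((pos Φ L).erase a) (fun b => ⟪b, a⟫ = 0)]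
  congr 2
  · refine Finset.prod_congr ?_ fun _ _ => rfl
    ext b
    simp only [Finset.mem_filter, Finset.mem_erase, mem_pos, mem_perp]
    constructor
    · rintro ⟨⟨-, h1, h2⟩, h3⟩
      exact ⟨⟨h1, h3⟩, h2⟩
    · rintro ⟨⟨h1, h3⟩, h2⟩
      refine ⟨⟨?_, h1, h2⟩, h3⟩
      rintro rfl
      rw [inner_self_of_norm_one (hΦ.norm_one _ ha)] at h3
      exact one_ne_zero h3
  · refine Finset.prod_congr ?_ fun _ _ => rfl
    ext b
    simp only [Finset.mem_filter, Finset.mem_erase, mem_pos, mem_oblique]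
    constructor
    · rintro ⟨⟨h0, h1, h2⟩, h3⟩
      refine ⟨⟨h1, h0, ?_, h3⟩, h2⟩
      rintro rfl
      rw [inner_neg_left] at h2
      linarith
    · rintro ⟨⟨h1, h0, -, h3⟩, h2⟩
      exact ⟨⟨h0, h1, h2⟩, h3⟩

omit hΦ in
theorem mul_refl_mul_self {σ : E ≃ₗᵢ[ℝ] E} (h2 : σ * σ = 1) {a : E} (ha : ‖a‖ = 1)
    (h : σ a = a ∨ σ a = -a) : (σ * refl a) * (σ * refl a) = 1 := by
  have h1 := mul_refl_mul_inv σ ha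
  have h3 : refl (σ a) = refl a := by
    rcases h with h | h <;> rw [h]
    exact refl_neg a
  rw [h3, inv_eq_of_mul_eq_one_right h2] at h1
  rw [← mul_assoc, h1, refl_mul_self]

theorem mul_refl_mem_invols_perp {σ : E ≃ₗᵢ[ℝ] E} (hσ : σ ∈ invols Φ) {a : E} (ha : a ∈ Φ)
    (h : σ a = -a) : σ * refl a ∈ invols (StableConstants.perp Φ a) := by
  rw [hΦ.mem_invols] at hσ
  rw [(hΦ.perp a).mem_invols]
  refine ⟨hΦ.mem_reflGroup_perp (mul_mem hσ.1 (refl_mem_reflGroup ha)) ?_,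
    mul_refl_mul_self hσ.2 (hΦ.norm_one a ha) (Or.inr h)⟩
  have : (σ * refl a) a = σ (refl a a) := rfl
  rw [this, refl_self, map_neg, h, neg_neg]

theorem apply_self_of_mem_perp {τ : E ≃ₗᵢ[ℝ] E} {a : E}
    (hτ : τ ∈ reflGroup (StableConstants.perp Φ a)) : τ a = a :=
  (hΦ.perp a).apply_eq_self hτ fun _ hb => (mem_perp.1 hb).2

omit hΦ in
theorem perp_subset (Φ : Finset E) (a : E) : StableConstants.perp Φ a ⊆ Φ :=
  fun _ hb => (mem_perp.1 hb).1

theorem mem_invols_of_perp {τ : E ≃ₗᵢ[ℝ] E} {a : E} :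
    τ ∈ invols (StableConstants.perp Φ a) ↔ τ ∈ invols Φ ∧ τ a = a := by
  rw [(hΦ.perp a).mem_invols, hΦ.mem_invols]
  constructor
  · rintro ⟨h1, h2⟩
    exact ⟨⟨reflGroup_le (perp_subset Φ a) h1, h2⟩, hΦ.apply_self_of_mem_perp h1⟩
  · rintro ⟨⟨h1, h2⟩, h3⟩
    exact ⟨hΦ.mem_reflGroup_perp h1 h3, h2⟩

theorem mul_refl_mem_invols {τ : E ≃ₗᵢ[ℝ] E} {a : E} (ha : a ∈ Φ)
    (hτ : τ ∈ invols (StableConstants.perp Φ a)) :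
    τ * refl a ∈ invols Φ ∧ (τ * refl a) a = -a := by
  obtain ⟨h1, h3⟩ := hΦ.mem_invols_of_perp.1 hτ
  rw [hΦ.mem_invols] at h1 ⊢
  refine ⟨⟨mul_mem h1.1 (refl_mem_reflGroup ha),
    mul_refl_mul_self h1.2 (hΦ.norm_one a ha) (Or.inl h3)⟩, ?_⟩
  have : (τ * refl a) a = τ (refl a a) := rfl
  rw [this, refl_self, map_neg, h3]

theorem fixSpace_of_neg (hn : HasNeg Φ) {σ : E ≃ₗᵢ[ℝ] E} {a : E}
    (ha : a ∈ Φ) (h : σ a = -a) :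
    fixSpace Φ σ = fixSpace (StableConstants.perp Φ a) (σ * refl a) := by
  ext x
  rw [mem_fixSpace, mem_fixSpace]
  have e : (σ * refl a) x = σ (refl a x) := rfl
  constructor
  · rintro ⟨h1, h2⟩
    have hxa : ⟪x, a⟫ = 0 := by
      have := LinearIsometryEquiv.inner_map_map σ x a
      rw [h2, h, inner_neg_right] at this
      linarith
    refine ⟨hΦ.mem_span_perp hn ha h1 hxa, ?_⟩
    rw [e, refl_of_inner_eq_zero (hΦ.norm_one a ha) (by rwa [real_inner_comm]), h2]
  · rintro ⟨h1, h2⟩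
    refine ⟨Submodule.span_mono (by exact_mod_cast perp_subset Φ a) h1, ?_⟩
    have hxa : ⟪a, x⟫ = 0 := by
      have : x ∈ (ℝ ∙ a)ᗮ := by
        refine (Submodule.span_le.2 fun b hb => ?_) h1
        rw [SetLike.mem_coe, Submodule.mem_orthogonal_singleton_iff_inner_left]
        exact (mem_perp.1 hb).2
      rwa [Submodule.mem_orthogonal_singleton_iff_inner_right] at this
    rwa [e, refl_of_inner_eq_zero (hΦ.norm_one a ha) hxa] at h2

/-- On a wall of the chamber of `x`, the summand of an involution which negates the root `a` of
the wall becomes a summand for the roots orthogonal to `a`. -/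
theorem summand_of_neg (hn : HasNeg Φ) {L : E} (hL : Regular Φ L) {a : E} (ha : a ∈ Φ)
    (haL : 0 < ⟪a, L⟫) {x y : E} (hy : ⟪a, y⟫ = 0)
    (hxy : ∀ b ∈ Φ, b ≠ a → b ≠ -a → 0 < ⟪b, x⟫ * ⟪b, y⟫) {σ : E ≃ₗᵢ[ℝ] E}
    (hσ : σ ∈ invols Φ) (h : σ a = -a) :
    summand Φ L x σ = summand (StableConstants.perp Φ a) L y (σ * refl a) := by
  obtain ⟨h1, h2⟩ := hΦ.mem_invols.1 hσ
  have ha1 := hΦ.norm_one a ha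
  have hne : ∀ b ∈ StableConstants.perp Φ a, b ≠ a ∧ b ≠ -a := by
    intro b hb
    have h3 := (mem_perp.1 hb).2
    constructor <;> rintro rfl
    · rw [inner_self_of_norm_one ha1] at h3
      exact one_ne_zero h3
    · rw [inner_neg_left, inner_self_of_norm_one ha1] at h3
      exact neg_ne_zero.2 one_ne_zero h3
  have e1 : factor σ L x a = 1 := by rw [factor, if_pos h]
  have e2 : ∏ b ∈ pos (oblique Φ a) L, factor σ L x b = 1 := by
    rw [← hΦ.prod_factor_eq_one (hΦ.apply_mem h1) (apply_apply_of_mul_self h2) ha h hL hy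
      (fun b hb h3 h4 => right_ne_zero_of_mul (hxy b hb h3 h4).ne') (M := oblique Φ a)
      fun b => mem_oblique]
    refine Finset.prod_congr rfl fun b hb => ?_
    obtain ⟨h3, h4, h5, -⟩ := mem_oblique.1 (mem_pos.1 hb).1
    exact factor_congr σ L (hxy b h3 h4 h5)
  rw [summand, summand, hΦ.fixSpace_of_neg hn ha h, hΦ.prod_pos_split ha haL, e1, e2, one_mul,
    mul_one]
  congr 1
  refine Finset.prod_congr rfl fun b hb => ?_
  have hb' := (mem_pos.1 hb).1
  rw [factor_congr σ L (hxy b (mem_perp.1 hb').1 (hne b hb').1 (hne b hb').2)]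
  refine factor_congr_left L y ?_
  have : (σ * refl a) b = σ (refl a b) := rfl
  rw [this, refl_of_inner_eq_zero ha1 (by rw [real_inner_comm]; exact (mem_perp.1 hb').2)]

omit hΦ in
/-- The summands of the other involutions change sign across the wall. -/
theorem summand_add_summand {L : E} {a : E} (ha : a ∈ Φ)
    (haL : 0 < ⟪a, L⟫) {x x' y : E} (hxa : ⟪a, x⟫ * ⟪a, x'⟫ < 0)
    (hxy : ∀ b ∈ Φ, b ≠ a → b ≠ -a → 0 < ⟪b, x⟫ * ⟪b, y⟫ ∧ 0 < ⟪b, x'⟫ * ⟪b, y⟫)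
    {σ : E ≃ₗᵢ[ℝ] E} (h : σ a ≠ -a) : summand Φ L x σ + summand Φ L x' σ = 0 := by
  classical
  have hmem : a ∈ pos Φ L := mem_pos.2 ⟨ha, haL⟩
  have e1 : factor σ L x' a = -factor σ L x a := by
    have : sg ⟪a, x'⟫ = -sg ⟪a, x⟫ := by
      rcases mul_neg_iff.1 hxa with ⟨h1, h2⟩ | ⟨h1, h2⟩
      · rw [sg_of_pos h1, sg_of_neg h2]
      · rw [sg_of_neg h1, sg_of_pos h2, neg_neg]
    simp only [factor, if_neg h, sg_mul, this]
    ring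
  have e2 : ∏ b ∈ (pos Φ L).erase a, factor σ L x' b
      = ∏ b ∈ (pos Φ L).erase a, factor σ L x b := by
    refine Finset.prod_congr rfl fun b hb => ?_
    obtain ⟨h1, h2⟩ := Finset.mem_erase.1 hb
    rw [mem_pos] at h2
    have h3 : b ≠ -a := by
      rintro rfl
      rw [inner_neg_left] at h2
      linarith [h2.2]
    have := hxy b h2.1 h1 h3
    rw [factor_congr σ L this.1, factor_congr σ L this.2]
  rw [summand, summand, ← Finset.mul_prod_erase _ _ hmem, ← Finset.mul_prod_erase _ _ hmem, e1, e2]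
  ring

theorem sum_of_neg {a : E} (ha : a ∈ Φ) (f : (E ≃ₗᵢ[ℝ] E) → ℂ) :
    open Classical in
    ∑ σ ∈ invols Φ with σ a = -a, f (σ * refl a)
      = ∑ τ ∈ invols (StableConstants.perp Φ a), f τ := by
  classical
  refine Finset.sum_nbij' (· * refl a) (· * refl a) ?_ ?_ ?_ ?_ fun _ _ => rfl
  · intro σ hσ
    rw [Finset.mem_filter] at hσ
    exact hΦ.mul_refl_mem_invols_perp hσ.1 ha hσ.2
  · intro τ hτ
    rw [Finset.mem_filter]
    exact hΦ.mul_refl_mem_invols ha hτ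
  all_goals
    intro σ _
    rw [mul_assoc, refl_mul_self, mul_one]

theorem formula_add_aux (hn : HasNeg Φ) {L : E} (hL : Regular Φ L) {a : E} (ha : a ∈ Φ)
    (haL : 0 < ⟪a, L⟫) {x x' y : E} (hy : ⟪a, y⟫ = 0) (hxa : ⟪a, x⟫ * ⟪a, x'⟫ < 0)
    (hxy : ∀ b ∈ Φ, b ≠ a → b ≠ -a → 0 < ⟪b, x⟫ * ⟪b, y⟫ ∧ 0 < ⟪b, x'⟫ * ⟪b, y⟫) :
    formula Φ L x + formula Φ L x' = 2 * formula (StableConstants.perp Φ a) L y := by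
  classical
  rw [formula, formula, ← Finset.sum_add_distrib,
    ← Finset.sum_filter_add_sum_filter_not (invols Φ) (fun σ => σ a = -a)]
  have e2 : ∑ σ ∈ invols Φ with ¬ σ a = -a, (summand Φ L x σ + summand Φ L x' σ) = 0 :=
    Finset.sum_eq_zero fun σ hσ =>
      summand_add_summand ha haL hxa hxy (Finset.mem_filter.1 hσ).2
  rw [e2, add_zero, formula, ← hΦ.sum_of_neg ha, Finset.mul_sum]
  refine Finset.sum_congr (by congr) fun σ hσ => ?_
  rw [Finset.mem_filter] at hσ
  rw [hΦ.summand_of_neg hn hL ha haL hy (fun b hb h1 h2 => (hxy b hb h1 h2).1) hσ.1 hσ.2,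
    hΦ.summand_of_neg hn hL ha haL hy (fun b hb h1 h2 => (hxy b hb h1 h2).2) hσ.1 hσ.2]
  ring

/-- The formula satisfies the wall-crossing rule. -/
theorem formula_add (hn : HasNeg Φ) {L : E} (hL : Regular Φ L) {a : E} (ha : a ∈ Φ)
    {x x' y : E} (hy : ⟪a, y⟫ = 0) (hxa : ⟪a, x⟫ * ⟪a, x'⟫ < 0)
    (hxy : ∀ b ∈ Φ, b ≠ a → b ≠ -a → 0 < ⟪b, x⟫ * ⟪b, y⟫ ∧ 0 < ⟪b, x'⟫ * ⟪b, y⟫) :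
    formula Φ L x + formula Φ L x' = 2 * formula (StableConstants.perp Φ a) L y := by
  rcases lt_or_gt_of_ne (hL a ha) with h | h
  · rw [← perp_neg]
    refine hΦ.formula_add_aux hn hL (hΦ.neg_mem ha) (by simpa using h) (by simpa using hy)
      (by simpa using hxa) fun b hb h1 h2 => hxy b hb (fun h => h2 (by rw [h, neg_neg])) h1
  · exact hΦ.formula_add_aux hn hL ha h hy hxa hxy

end IsUnitSystem

/-! ### Vanishing on the dual chamber -/

theorem formula_congr {Φ : Finset E} (L : E) {x y : E} (h : ∀ b ∈ Φ, 0 < ⟪b, x⟫ * ⟪b, y⟫) :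
    formula Φ L x = formula Φ L y := by
  refine Finset.sum_congr rfl fun σ _ => ?_
  rw [summand, summand]
  congr 1
  exact Finset.prod_congr rfl fun b hb => factor_congr σ L (h b (mem_pos.1 hb).1)

theorem finrank_fixSpace_conj {Φ : Finset E} {w : E ≃ₗᵢ[ℝ] E} (hw : ∀ b ∈ Φ, w b ∈ Φ)
    (hw' : ∀ b ∈ Φ, w⁻¹ b ∈ Φ) (σ : E ≃ₗᵢ[ℝ] E) :
    finrank ℝ (fixSpace Φ (w * σ * w⁻¹)) = finrank ℝ (fixSpace Φ σ) := by
  have key : ∀ {u : E ≃ₗᵢ[ℝ] E}, (∀ b ∈ Φ, u b ∈ Φ) → ∀ x ∈ Submodule.span ℝ (Φ : Set E),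
      u x ∈ Submodule.span ℝ (Φ : Set E) := by
    intro u hu x hx
    have : Submodule.span ℝ (Φ : Set E) ≤
        (Submodule.span ℝ (Φ : Set E)).comap u.toLinearEquiv.toLinearMap :=
      Submodule.span_le.2 fun b hb => Submodule.subset_span (hu b hb)
    exact this hx
  have hww : ∀ x, w (w⁻¹ x) = x := w.apply_symm_apply
  have hww' : ∀ x, w⁻¹ (w x) = x := w.symm_apply_apply
  have e : fixSpace Φ (w * σ * w⁻¹) = (fixSpace Φ σ).map w.toLinearEquiv.toLinearMap := by
    ext x
    rw [mem_fixSpace, Submodule.mem_map]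
    have e1 : (w * σ * w⁻¹) x = w (σ (w⁻¹ x)) := rfl
    constructor
    · rintro ⟨h1, h2⟩
      refine ⟨w⁻¹ x, mem_fixSpace.2 ⟨key hw' x h1, ?_⟩, hww x⟩
      rw [e1] at h2
      conv_rhs => rw [← h2]
      rw [hww']
    · rintro ⟨y, hy, rfl⟩
      rw [mem_fixSpace] at hy
      refine ⟨key hw y hy.1, ?_⟩
      have e2 : (w * σ * w⁻¹) (w y) = w (σ (w⁻¹ (w y))) := rfl
      change (w * σ * w⁻¹) (w y) = w y
      rw [e2, hww', hy.2]
  rw [e]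
  exact LinearEquiv.finrank_map_eq w.toLinearEquiv _

theorem finiteDimensional_fixSpace (Φ : Finset E) (σ : E ≃ₗᵢ[ℝ] E) :
    FiniteDimensional ℝ (fixSpace Φ σ) := by
  have := FiniteDimensional.span_finset ℝ Φ
  exact Submodule.finiteDimensional_of_le (inf_le_left : fixSpace Φ σ ≤ _)

theorem lt_zero_congr {p q p' q' : ℝ} (hp : 0 < p * p') (hq : 0 < q * q') :
    p' * q' < 0 ↔ p * q < 0 := by
  have h : 0 < (p * q) * (p' * q') := by
    have := mul_pos hp hq
    linarith
  constructor
  · intro h'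
    exact neg_of_mul_pos_left h h'.le
  · intro h'
    exact neg_of_mul_pos_right h h'.le

namespace IsUnitSystem

variable {Φ : Finset E} (hΦ : IsUnitSystem Φ)
include hΦ

theorem finrank_fixSpace_of_fixed (hn : HasNeg Φ) {σ : E ≃ₗᵢ[ℝ] E} {a : E}
    (ha : a ∈ Φ) (h : σ a = a) :
    finrank ℝ (fixSpace Φ σ) = finrank ℝ (fixSpace (StableConstants.perp Φ a) σ) + 1 := by
  have ha1 := hΦ.norm_one a ha
  have horth : ∀ x ∈ fixSpace (StableConstants.perp Φ a) σ, ⟪x, a⟫ = 0 := by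
    intro x hx
    have : x ∈ (ℝ ∙ a)ᗮ := by
      refine (Submodule.span_le.2 fun b hb => ?_) (mem_fixSpace.1 hx).1
      rw [SetLike.mem_coe, Submodule.mem_orthogonal_singleton_iff_inner_left]
      exact (mem_perp.1 hb).2
    rwa [Submodule.mem_orthogonal_singleton_iff_inner_left] at this
  have e : fixSpace Φ σ = fixSpace (StableConstants.perp Φ a) σ ⊔ ℝ ∙ a := by
    apply le_antisymm
    · intro x hx
      obtain ⟨h1, h2⟩ := mem_fixSpace.1 hx
      have hx' : x = (x - ⟪x, a⟫ • a) + ⟪x, a⟫ • a := by abel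
      rw [hx']
      refine Submodule.add_mem_sup (mem_fixSpace.2 ⟨hΦ.mem_span_perp hn ha ?_ ?_, ?_⟩)
        (Submodule.smul_mem _ _ (Submodule.mem_span_singleton_self a))
      · exact Submodule.sub_mem _ h1 (Submodule.smul_mem _ _ (Submodule.subset_span ha))
      · rw [inner_sub_left, inner_smul_left, inner_self_of_norm_one ha1]
        simp
      · rw [map_sub, map_smul, h, h2]
    · rw [sup_le_iff, Submodule.span_singleton_le_iff_mem]
      refine ⟨fun x hx => ?_, mem_fixSpace.2 ⟨Submodule.subset_span ha, h⟩⟩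
      obtain ⟨h1, h2⟩ := mem_fixSpace.1 hx
      exact mem_fixSpace.2 ⟨Submodule.span_mono (by exact_mod_cast perp_subset Φ a) h1, h2⟩
  have hinf : fixSpace (StableConstants.perp Φ a) σ ⊓ ℝ ∙ a = ⊥ := by
    rw [eq_bot_iff]
    rintro x ⟨h1, h2⟩
    obtain ⟨c, rfl⟩ := Submodule.mem_span_singleton.1 h2
    have := horth _ h1
    rw [inner_smul_left, inner_self_of_norm_one ha1] at this
    simp only [conj_trivial, mul_one] at this
    simp [this]
  have := finiteDimensional_fixSpace (StableConstants.perp Φ a) σ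
  have h3 := Submodule.finrank_sup_add_finrank_inf_eq (fixSpace (StableConstants.perp Φ a) σ) (ℝ ∙ a)
  rw [hinf, finrank_bot, add_zero, finrank_span_singleton (hΦ.ne_zero ha)] at h3
  rw [e, h3]

theorem factor_conj {L a : E} (hL : Regular Φ L) (ha : IsSimple Φ L a) {σ : E ≃ₗᵢ[ℝ] E} {b : E}
    (hb : b ∈ Φ) (hσb : σ b ∈ Φ) (h1 : b ≠ a) (h2 : b ≠ -a) (h3 : σ b ≠ a) (h4 : σ b ≠ -a) :
    factor (refl a * σ * (refl a)⁻¹) L L (refl a b) = factor σ L L b := by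
  have e : (refl a * σ * (refl a)⁻¹) (refl a b) = refl a (σ b) := by
    rw [refl_inv]
    change refl a (σ (refl a (refl a b))) = _
    rw [refl_refl]
  have e1 : (refl a (σ b) = -refl a b) = (σ b = -b) := by
    rw [← map_neg]
    exact propext (refl a).injective.eq_iff
  have e2 : (refl a (σ b) = refl a b) = (σ b = b) := propext (refl a).injective.eq_iff
  have e3 : ⟪refl a (σ b), L⟫ * ⟪refl a b, L⟫ < 0 ↔ ⟪σ b, L⟫ * ⟪b, L⟫ < 0 :=
    lt_zero_congr (hΦ.simple_pos ha hσb h3 h4) (hΦ.simple_pos ha hb h1 h2)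
  have e4 : sg (⟪refl a b, L⟫ * ⟪refl a b, L⟫) = sg (⟪b, L⟫ * ⟪b, L⟫) := by
    rw [sg_of_pos (mul_self_pos.2 (hL b hb)),
      sg_of_pos (mul_self_pos.2 (hL _ (hΦ.refl_mem a ha.1 b hb)))]
  unfold factor
  rw [e, e1, e2, e4]
  congr 2
  by_cases h : ⟪σ b, L⟫ * ⟪b, L⟫ < 0 ∨ σ b = b
  · rw [if_pos h, if_pos (h.imp_left e3.2)]
  · rw [if_neg h, if_neg fun h' => h (h'.imp_left e3.1)]

theorem prod_pos_split_two {a c L : E} (ha : a ∈ Φ) (hc : c ∈ Φ) (hL : Regular Φ L)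
    (haL : 0 < ⟪a, L⟫) (h1 : c ≠ a) (h2 : c ≠ -a) {f : E → ℂ} (hf : ∀ b, f (-b) = f b) :
    open Classical in
    ∏ b ∈ pos Φ L, f b = (f a * f c) * ∏ b ∈ pos Φ L with b ≠ a ∧ b ≠ c ∧ b ≠ -c, f b := by
  classical
  wlog hcL : 0 < ⟪c, L⟫ generalizing c
  · have := this (c := -c) (hΦ.neg_mem hc) (fun h => h2 (by rw [← h, neg_neg]))
      (fun h => h1 (neg_injective h)) (by
        rw [inner_neg_left]
        exact neg_pos.2 (lt_of_le_of_ne (not_lt.1 hcL) (hL c hc)))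
    rw [this, hf, neg_neg]
    congr 1
    refine Finset.prod_congr ?_ fun _ _ => rfl
    ext b
    simp only [Finset.mem_filter]
    tauto
  rw [← Finset.mul_prod_erase (pos Φ L) f (mem_pos.2 ⟨ha, haL⟩),
    ← Finset.mul_prod_erase _ f (Finset.mem_erase.2 ⟨h1, mem_pos.2 ⟨hc, hcL⟩⟩), mul_assoc]
  congr 2
  refine Finset.prod_congr ?_ fun _ _ => rfl
  ext b
  simp only [Finset.mem_filter, Finset.mem_erase, mem_pos]
  constructor
  · rintro ⟨h3, h4, h5, h6⟩
    refine ⟨⟨h5, h6⟩, h4, h3, ?_⟩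
    rintro rfl
    rw [inner_neg_left] at h6
    linarith
  · rintro ⟨⟨h5, h6⟩, h4, h3, -⟩
    exact ⟨h3, h4, h5, h6⟩

/-- Conjugation by a simple reflection changes the length of an involution by two, unless they
commute. -/
theorem summand_conj {L a : E} (hL : Regular Φ L) (ha : IsSimple Φ L a) {σ : E ≃ₗᵢ[ℝ] E}
    (hσ : σ ∈ invols Φ) (h1 : σ a ≠ a) (h2 : σ a ≠ -a) :
    summand Φ L L (refl a * σ * (refl a)⁻¹) = -summand Φ L L σ := by
  classical
  obtain ⟨hσW, hσ2⟩ := hΦ.mem_invols.1 hσ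
  have hσσ := apply_apply_of_mul_self hσ2
  have hs := refl_mem_reflGroup ha.1
  set σ' := refl a * σ * (refl a)⁻¹ with hσ'
  have hσ'a : σ' a = -refl a (σ a) := by
    rw [hσ', refl_inv]
    change refl a (σ (refl a a)) = _
    rw [refl_self, map_neg, map_neg]
  have hσ'σ' : ∀ x, σ' (σ' x) = x := by
    apply apply_apply_of_mul_self
    rw [hσ']
    have : refl a * σ * (refl a)⁻¹ * (refl a * σ * (refl a)⁻¹)
        = refl a * (σ * σ) * (refl a)⁻¹ := by group
    rw [this, hσ2, mul_one, mul_inv_cancel]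
  have hσaΦ : σ a ∈ Φ := hΦ.apply_mem hσW a ha.1
  have hn := refl_ne h1 h2
  have hσ'aΦ : σ' a ∈ Φ := by
    rw [hσ'a]
    exact hΦ.neg_mem (hΦ.refl_mem a ha.1 _ hσaΦ)
  have h1' : σ' a ≠ a := by
    rw [hσ'a]
    exact fun h => hn.2 (neg_eq_iff_eq_neg.1 h)
  have h2' : σ' a ≠ -a := by
    rw [hσ'a]
    exact fun h => hn.1 (neg_injective h)
  have hfin : finrank ℝ (fixSpace Φ σ') = finrank ℝ (fixSpace Φ σ) :=
    finrank_fixSpace_conj (hΦ.apply_mem hs) (hΦ.apply_mem (inv_mem hs)) σ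
  have hrest : ∏ b ∈ pos Φ L with b ≠ a ∧ b ≠ σ' a ∧ b ≠ -σ' a, factor σ' L L b
      = ∏ b ∈ pos Φ L with b ≠ a ∧ b ≠ σ a ∧ b ≠ -σ a, factor σ L L b := by
    have hna : ∀ {b : E}, 0 < ⟪b, L⟫ → b ≠ -a := by
      rintro b hb rfl
      rw [inner_neg_left] at hb
      linarith [ha.2.1]
    have hpos : ∀ {b : E}, b ∈ Φ → 0 < ⟪b, L⟫ → b ≠ a → 0 < ⟪refl a b, L⟫ := fun hb hbL h =>
      (pos_iff_pos_of_mul_pos (hΦ.simple_pos ha hb h (hna hbL))).1 hbL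
    symm
    refine Finset.prod_nbij' (refl a) (refl a) ?_ ?_ (fun b _ => refl_refl a b)
      (fun b _ => refl_refl a b) ?_
    · intro b hb
      simp only [Finset.mem_filter, mem_pos, hσ'a, neg_neg] at hb ⊢
      obtain ⟨⟨hb, hbL⟩, h3, h4, h5⟩ := hb
      refine ⟨⟨hΦ.refl_mem a ha.1 b hb, hpos hb hbL h3⟩, (refl_ne h3 (hna hbL)).1, ?_,
        fun h => h4 ((refl a).injective h)⟩
      rw [← map_neg]
      exact fun h => h5 ((refl a).injective h)
    · intro b hb
      simp only [Finset.mem_filter, mem_pos, hσ'a, neg_neg] at hb ⊢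
      obtain ⟨⟨hb, hbL⟩, h3, h4, h5⟩ := hb
      refine ⟨⟨hΦ.refl_mem a ha.1 b hb, hpos hb hbL h3⟩, (refl_ne h3 (hna hbL)).1, ?_, ?_⟩
      · intro h
        exact h5 (by rw [← h, refl_refl])
      · intro h
        exact h4 (by rw [← map_neg, ← h, refl_refl])
    · intro b hb
      simp only [Finset.mem_filter, mem_pos] at hb
      obtain ⟨⟨hb, hbL⟩, h3, h4, h5⟩ := hb
      refine (hΦ.factor_conj hL ha hb (hΦ.apply_mem hσW b hb) h3 (hna hbL) ?_ ?_).symm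
      · exact fun h => h4 (by rw [← h, hσσ])
      · exact fun h => h5 (by rw [← map_neg, ← h, hσσ])
  have hsign : sg (⟪a, L⟫ * ⟪σ' a, L⟫) = -sg (⟪a, L⟫ * ⟪σ a, L⟫) := by
    have hn' : sg (-⟪refl a (σ a), L⟫) = -sg ⟪refl a (σ a), L⟫ := by
      rw [← neg_one_mul, sg_mul, sg_of_neg neg_one_lt_zero, neg_one_mul]
    rw [sg_mul, sg_mul, hσ'a, inner_neg_left, hn',
      sg_eq_of_mul_pos (hΦ.simple_pos ha hσaΦ h1 h2)]
    ring
  rw [summand, summand, hfin,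
    hΦ.prod_pos_split_two ha.1 hσaΦ hL ha.2.1 h1 h2 (factor_neg σ L L),
    hΦ.prod_pos_split_two ha.1 hσ'aΦ hL ha.2.1 h1' h2' (factor_neg σ' L L), hrest,
    factor_mul_factor_apply hσσ h1 h2 (hL a ha.1) (hL _ hσaΦ),
    factor_mul_factor_apply hσ'σ' h1' h2' (hL a ha.1) (hL _ hσ'aΦ), hsign]
  ring

/-- For an involution which fixes a simple root `a`, passing to the roots orthogonal to `a`
multiplies the summand by a sign which does not depend on the involution. -/
theorem summand_of_fixed (hn : HasNeg Φ) {L a : E} (hL : Regular Φ L) (ha : IsSimple Φ L a)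
    {σ : E ≃ₗᵢ[ℝ] E} (hσ : σ ∈ invols Φ) (h : σ a = a) :
    summand Φ L L σ = -(-1) ^ (pos (pos (oblique Φ a) L) a).card *
      summand (StableConstants.perp Φ a) L L σ := by
  classical
  obtain ⟨hσW, hσ2⟩ := hΦ.mem_invols.1 hσ
  have hσσ := apply_apply_of_mul_self hσ2
  have ha1 := hΦ.norm_one a ha.1
  have hσa : ∀ b, ⟪σ b, a⟫ = ⟪b, a⟫ := fun b => by
    conv_lhs => rw [← h]
    exact LinearIsometryEquiv.inner_map_map σ b a
  have hcomm : refl a * σ * (refl a)⁻¹ = σ := by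
    have := mul_refl_mul_inv σ ha1
    rw [h] at this
    have h' : σ * refl a = refl a * σ := by
      conv_rhs => rw [← this]
      group
    rw [← h', mul_assoc, mul_inv_cancel, mul_one]
  have hsa : ∀ b, ⟪refl a b, a⟫ = -⟪b, a⟫ := fun b => by
    rw [inner_refl_left, refl_self, inner_neg_right]
  have hσne : ∀ {b : E}, b ≠ a → b ≠ -a → σ b ≠ a ∧ σ b ≠ -a := fun {b} h1 h2 =>
    ⟨fun h' => h1 (by rw [← hσσ b, h', h]), fun h' => h2 (by rw [← hσσ b, h', map_neg, h])⟩
  have hfa : factor σ L L a = Complex.I := by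
    have : σ a ≠ -a := by rw [h]; exact hΦ.self_ne_neg ha.1
    rw [factor, if_neg this, if_pos (Or.inr h), sg_of_pos (mul_self_pos.2 (hL a ha.1)), one_mul]
  set T := pos (pos (oblique Φ a) L) a with hT
  have hmemT : ∀ b, b ∈ T ↔ b ∈ Φ ∧ b ≠ a ∧ b ≠ -a ∧ 0 < ⟪b, L⟫ ∧ 0 < ⟪b, a⟫ := by
    intro b
    rw [hT, mem_pos, mem_pos, mem_oblique]
    constructor
    · rintro ⟨⟨⟨h1, h2, h3, -⟩, h4⟩, h5⟩
      exact ⟨h1, h2, h3, h4, h5⟩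
    · rintro ⟨h1, h2, h3, h4, h5⟩
      exact ⟨⟨⟨h1, h2, h3, h5.ne'⟩, h4⟩, h5⟩
  have hpos : ∀ {b : E}, b ∈ Φ → b ≠ a → b ≠ -a → 0 < ⟪b, L⟫ → 0 < ⟪refl a b, L⟫ :=
    fun hb h1 h2 hbL => (pos_iff_pos_of_mul_pos (hΦ.simple_pos ha hb h1 h2)).1 hbL
  have hsplit : ∏ b ∈ pos (oblique Φ a) L, factor σ L L b
      = ∏ b ∈ T, factor σ L L b * factor σ L L b := by
    rw [Finset.prod_mul_distrib, ← Finset.prod_filter_mul_prod_filter_not (pos (oblique Φ a) L)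
      (fun b => 0 < ⟪b, a⟫)]
    have hfilter : (pos (oblique Φ a) L).filter (fun b => 0 < ⟪b, a⟫) = T := by
      ext b
      rw [Finset.mem_filter, hT, mem_pos (L := a)]
    rw [hfilter]
    congr 1
    · refine Finset.prod_nbij' (refl a) (refl a) ?_ ?_ (fun b _ => refl_refl a b)
        (fun b _ => refl_refl a b) ?_
      · intro b hb
        simp only [Finset.mem_filter, mem_pos, mem_oblique] at hb
        obtain ⟨⟨⟨hb, h1, h2, h3⟩, h4⟩, h5⟩ := hb
        refine (hmemT _).2 ⟨hΦ.refl_mem a ha.1 b hb, (refl_ne h1 h2).1, (refl_ne h1 h2).2,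
          hpos hb h1 h2 h4, ?_⟩
        rw [hsa]
        exact neg_pos.2 (lt_of_le_of_ne (not_lt.1 h5) h3)
      · intro b hb
        obtain ⟨hb, h1, h2, h3, h4⟩ := (hmemT b).1 hb
        simp only [Finset.mem_filter, mem_pos, mem_oblique]
        refine ⟨⟨⟨hΦ.refl_mem a ha.1 b hb, (refl_ne h1 h2).1, (refl_ne h1 h2).2, ?_⟩,
          hpos hb h1 h2 h3⟩, ?_⟩
        · rw [hsa]; exact (neg_neg_of_pos h4).ne
        · rw [hsa]; exact (neg_neg_of_pos h4).not_gt
      · intro b hb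
        simp only [Finset.mem_filter, mem_pos, mem_oblique] at hb
        obtain ⟨⟨⟨hb, h1, h2, h3⟩, h4⟩, h5⟩ := hb
        have := hΦ.factor_conj hL ha hb (hΦ.apply_mem hσW b hb) h1 h2 (hσne h1 h2).1 (hσne h1 h2).2
        rw [hcomm] at this
        exact this.symm
  have hsq : ∀ b ∈ T, factor σ L L b * factor σ L L b
      = -1 * if 0 < ⟪σ b, L⟫ ∧ σ b ≠ b then -1 else 1 := by
    intro b hb
    obtain ⟨hb, h1, h2, h3, h4⟩ := (hmemT b).1 hb
    have hne : σ b ≠ -b := by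
      intro h'
      have := hσa b
      rw [h', inner_neg_left] at this
      linarith
    have hreg := hL _ (hΦ.apply_mem hσW b hb)
    simp only [factor, if_neg hne, sg_of_pos (mul_self_pos.2 h3.ne'), one_mul]
    by_cases hc : 0 < ⟪σ b, L⟫ ∧ σ b ≠ b
    · have hc' : ¬ (⟪σ b, L⟫ * ⟪b, L⟫ < 0 ∨ σ b = b) := by
        rintro (h' | h')
        · exact (mul_pos hc.1 h3).not_gt h'
        · exact hc.2 h'
      rw [if_pos hc, if_neg hc']
      norm_num
    · have hc' : ⟪σ b, L⟫ * ⟪b, L⟫ < 0 ∨ σ b = b := by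
        by_contra! h'
        apply hc
        refine ⟨?_, h'.2⟩
        exact lt_of_le_of_ne (nonneg_of_mul_nonneg_left h'.1 h3) hreg.symm
      rw [if_neg hc, if_pos hc', Complex.I_mul_I, mul_one]
  -- `σ` permutes in pairs the members of `T` which it moves to positive roots
  have hpair : ∏ b ∈ T, (if 0 < ⟪σ b, L⟫ ∧ σ b ≠ b then (-1 : ℂ) else 1) = 1 := by
    refine Finset.prod_involution (fun b _ => if 0 < ⟪σ b, L⟫ then σ b else b) ?_ ?_ ?_ ?_
    · intro b hb
      have hbL := ((hmemT b).1 hb).2.2.2.1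
      by_cases hs : 0 < ⟪σ b, L⟫
      · simp only [hs, if_true, hσσ, hbL, true_and, ne_eq, eq_comm (a := b)]
        split_ifs <;> norm_num
      · simp [hs]
    · intro b hb hb1
      have : 0 < ⟪σ b, L⟫ ∧ σ b ≠ b := by
        by_contra hc
        exact hb1 (if_neg hc)
      rw [if_pos this.1]
      exact this.2
    · intro b hb
      obtain ⟨hbΦ, h1, h2, h3, h4⟩ := (hmemT b).1 hb
      split_ifs with hs
      · exact (hmemT _).2 ⟨hΦ.apply_mem hσW b hbΦ, (hσne h1 h2).1, (hσne h1 h2).2, hs,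
          by rw [hσa]; exact h4⟩
      · exact hb
    · intro b hb
      have hbL := ((hmemT b).1 hb).2.2.2.1
      by_cases hs : 0 < ⟪σ b, L⟫
      · simp [hs, hσσ, hbL]
      · simp [hs]
  rw [summand, summand, hΦ.finrank_fixSpace_of_fixed hn ha.1 h, hΦ.prod_pos_split ha.1 ha.2.1,
    hfa, hsplit, Finset.prod_congr rfl hsq, Finset.prod_mul_distrib, hpair, Finset.prod_const,
    pow_succ]
  linear_combination ((-1 : ℂ) ^ T.card * Complex.I ^ finrank ℝ
    (fixSpace (StableConstants.perp Φ a) σ) * ∏ b ∈ pos (StableConstants.perp Φ a) L,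
      factor σ L L b) * Complex.I_mul_I

/-- On the chamber dual to `L`, the formula is a multiple of the formula for the roots orthogonal
to a simple root `a`. The involutions with `σ a = -a` contribute the term `1` of the factor, those
with `σ a = a` the signed term, and the others cancel under conjugation by `refl a`. -/
theorem formula_self_eq (hn : HasNeg Φ) {L a : E} (hL : Regular Φ L) (ha : IsSimple Φ L a) :
    formula Φ L L = (1 - (-1) ^ (pos (pos (oblique Φ a) L) a).card) *
      formula (StableConstants.perp Φ a) L L := by
  classical
  obtain ⟨haΦ, haL, y, hay, hy⟩ := id ha
  have hyL : ∀ b ∈ StableConstants.perp Φ a, 0 < ⟪b, L⟫ * ⟪b, y⟫ := by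
    intro b hb
    obtain ⟨hb, hba⟩ := mem_perp.1 hb
    have h1 := inner_self_of_norm_one (hΦ.norm_one a haΦ)
    refine hy b hb ?_ ?_
    · rintro rfl
      rw [h1] at hba
      exact one_ne_zero hba
    · rintro rfl
      rw [inner_neg_left, h1] at hba
      exact neg_ne_zero.2 one_ne_zero hba
  have e1 : ∑ σ ∈ invols Φ with σ a = -a, summand Φ L L σ
      = formula (StableConstants.perp Φ a) L L := by
    rw [formula_congr L hyL, formula, ← hΦ.sum_of_neg haΦ]
    refine Finset.sum_congr (by congr) fun σ hσ => ?_
    rw [Finset.mem_filter] at hσ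
    exact hΦ.summand_of_neg hn hL haΦ haL hay hy hσ.1 hσ.2
  have e2 : ∑ σ ∈ invols Φ with ¬ σ a = -a ∧ σ a = a, summand Φ L L σ
      = -(-1) ^ (pos (pos (oblique Φ a) L) a).card * formula (StableConstants.perp Φ a) L L := by
    rw [formula, Finset.mul_sum]
    refine Finset.sum_congr ?_ fun σ hσ => ?_
    · ext σ
      rw [Finset.mem_filter, hΦ.mem_invols_of_perp]
      refine and_congr_right fun _ => ⟨fun h => h.2, fun h => ⟨?_, h⟩⟩
      rw [h]
      exact hΦ.self_ne_neg haΦ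
    · rw [hΦ.mem_invols_of_perp] at hσ
      exact hΦ.summand_of_fixed hn hL ha hσ.1 hσ.2
  have e3 : ∑ σ ∈ invols Φ with ¬ σ a = -a ∧ ¬ σ a = a, summand Φ L L σ = 0 := by
    have key : ∀ σ ∈ invols Φ, ¬ σ a = -a → ¬ σ a = a →
        summand Φ L L (refl a * σ * (refl a)⁻¹) = -summand Φ L L σ :=
      fun σ hσ h1 h2 => hΦ.summand_conj hL ha hσ h2 h1
    refine Finset.sum_involution (fun σ _ => refl a * σ * (refl a)⁻¹) ?_ ?_ ?_ ?_
    · intro σ hσ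
      obtain ⟨h1, h2, h3⟩ := Finset.mem_filter.1 hσ
      rw [key σ h1 h2 h3, add_neg_cancel]
    · intro σ hσ h0 h
      obtain ⟨h1, h2, h3⟩ := Finset.mem_filter.1 hσ
      have := key σ h1 h2 h3
      rw [h] at this
      exact h0 (self_eq_neg.1 this)
    · intro σ hσ
      obtain ⟨h1, h2, h3⟩ := Finset.mem_filter.1 hσ
      obtain ⟨h4, h5⟩ := hΦ.mem_invols.1 h1
      have hs := refl_mem_reflGroup haΦ
      have hv : (refl a * σ * (refl a)⁻¹) a = -refl a (σ a) := by
        rw [refl_inv]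
        change refl a (σ (refl a a)) = _
        rw [refl_self, map_neg, map_neg]
      have hne := refl_ne h3 h2
      refine Finset.mem_filter.2 ⟨hΦ.mem_invols.2 ⟨mul_mem (mul_mem hs h4) (inv_mem hs), ?_⟩,
        ?_, ?_⟩
      · have : refl a * σ * (refl a)⁻¹ * (refl a * σ * (refl a)⁻¹)
            = refl a * (σ * σ) * (refl a)⁻¹ := by group
        rw [this, h5, mul_one, mul_inv_cancel]
      · rw [hv]
        exact fun h => hne.1 (neg_injective h)
      · rw [hv]
        exact fun h => hne.2 (neg_eq_iff_eq_neg.1 h)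
    · intro σ _
      have : refl a * (refl a * σ * (refl a)⁻¹) * (refl a)⁻¹
          = (refl a * refl a) * σ * (refl a * refl a)⁻¹ := by group
      rw [this, refl_mul_self, inv_one, one_mul, mul_one]
  have e4 := Finset.sum_filter_add_sum_filter_not (invols Φ) (fun σ => σ a = -a)
    (summand Φ L L)
  have e5 := Finset.sum_filter_add_sum_filter_not ((invols Φ).filter fun σ => ¬ σ a = -a)
    (fun σ => σ a = a) (summand Φ L L)
  rw [Finset.filter_filter, Finset.filter_filter, e2, e3] at e5
  rw [e1, ← e5] at e4
  rw [formula, ← e4]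
  ring

/-- The formula vanishes on the chamber dual to `L`. -/
theorem formula_self_eq_zero (hn : HasNeg Φ) {L : E} (hL : Regular Φ L) (hne : Φ.Nonempty) :
    formula Φ L L = 0 := by
  induction hcard : Φ.card using Nat.strong_induction_on generalizing Φ with
  | _ n ih =>
    obtain ⟨a, ha⟩ := hΦ.exists_isSimple hL hne
    have ha1 := hΦ.norm_one a ha.1
    rw [hΦ.formula_self_eq hn hL ha]
    rcases (StableConstants.perp Φ a).eq_empty_or_nonempty with h | h
    -- here all roots are proportional to `a`
    · have : pos (pos (oblique Φ a) L) a = ∅ := by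
        rw [Finset.eq_empty_iff_forall_notMem]
        intro b hb
        obtain ⟨h1, h2, h3, -⟩ := mem_oblique.1 (mem_pos.1 (mem_pos.1 hb).1).1
        apply hΦ.ne_or_of_inner ha.1 h1 h2 h3
        have hm := hΦ.mem_span_perp hn ha.1 (x := b - ⟪b, a⟫ • a)
          (Submodule.sub_mem _ (Submodule.subset_span h1)
            (Submodule.smul_mem _ _ (Submodule.subset_span ha.1))) (by
              rw [inner_sub_left, inner_smul_left, inner_self_of_norm_one ha1]
              simp)
        rw [h] at hm
        simpa using hm
      rw [this]
      simp
    · have hlt : (StableConstants.perp Φ a).card < n := by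
        rw [← hcard]
        refine Finset.card_lt_card ⟨perp_subset Φ a, fun h' => ?_⟩
        have := (mem_perp.1 (h' ha.1)).2
        rw [inner_self_of_norm_one ha1] at this
        exact one_ne_zero this
      rw [ih _ hlt (hΦ.perp a) (hΦ.hasNeg_perp hn ha.1) (fun b hb => hL b (mem_perp.1 hb).1) h rfl,
        mul_zero]

end IsUnitSystem

theorem formula_empty (L x : E) : formula (∅ : Finset E) L x = 1 := by
  have h : IsUnitSystem (∅ : Finset E) := ⟨by simp, by simp⟩
  have h1 : invols (∅ : Finset E) = {1} := by
    ext σ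
    rw [h.mem_invols, Finset.mem_singleton]
    constructor
    · rintro ⟨h1, -⟩
      simpa [reflGroup] using h1
    · rintro rfl
      exact ⟨one_mem _, one_mul _⟩
  have h2 : fixSpace (∅ : Finset E) 1 = ⊥ := by
    rw [eq_bot_iff]
    intro x hx
    simpa using (mem_fixSpace.1 hx).1
  rw [formula, h1, Finset.sum_singleton, summand, h2, finrank_bot]
  simp [pos]

/-! ### Equivariance and sums over orbits -/

theorem factor_apply (w σ : E ≃ₗᵢ[ℝ] E) (L x b : E) :
    factor (w * σ * w⁻¹) (w L) (w x) (w b) = factor σ L x b := by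
  have e : (w * σ * w⁻¹) (w b) = w (σ b) := by
    change w (σ (w⁻¹ (w b))) = _
    congr 2
    exact w.symm_apply_apply b
  have e1 : (w (σ b) = -w b) = (σ b = -b) := by
    rw [← map_neg]
    exact propext w.injective.eq_iff
  have e2 : (w (σ b) = w b) = (σ b = b) := propext w.injective.eq_iff
  unfold factor
  rw [e, e1, e2, LinearIsometryEquiv.inner_map_map, LinearIsometryEquiv.inner_map_map,
    LinearIsometryEquiv.inner_map_map]

/-- The weight of the involution `σ` multiplies the signs at `x` of the positive roots which `σ`
does not negate. -/
theorem summand_eq (Φ : Finset E) (L x : E) (σ : E ≃ₗᵢ[ℝ] E) :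
    open Classical in
    summand Φ L x σ = summand Φ L L σ * ∏ b ∈ pos (Φ.filter fun b => σ b ≠ -b) L, sg ⟪b, x⟫ := by
  classical
  have e : pos (Φ.filter fun b => σ b ≠ -b) L = (pos Φ L).filter fun b => σ b ≠ -b := by
    ext b
    simp only [mem_pos, Finset.mem_filter]
    tauto
  rw [summand, summand, mul_assoc, e, Finset.prod_filter, ← Finset.prod_mul_distrib]
  congr 1
  refine Finset.prod_congr rfl fun b hb => ?_
  have hb' := (mem_pos.1 hb).2
  by_cases h : σ b = -b
  · simp [factor, h]
  · have h' : σ b ≠ -b := h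
    rw [factor, factor, if_neg h, if_neg h, if_pos h', sg_mul, sg_mul, sg_of_pos hb']
    ring

namespace IsUnitSystem

variable {Φ : Finset E} (hΦ : IsUnitSystem Φ)
include hΦ

theorem formula_apply {w : E ≃ₗᵢ[ℝ] E} (hw : w ∈ reflGroup Φ) (L x : E) :
    formula Φ (w L) (w x) = formula Φ L x := by
  symm
  have hw' := inv_mem hw
  refine Finset.sum_nbij' (fun σ => w * σ * w⁻¹) (fun σ => w⁻¹ * σ * w) ?_ ?_ ?_ ?_ ?_
  · intro σ hσ
    rw [hΦ.mem_invols] at hσ ⊢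
    refine ⟨mul_mem (mul_mem hw hσ.1) hw', ?_⟩
    have : w * σ * w⁻¹ * (w * σ * w⁻¹) = w * (σ * σ) * w⁻¹ := by group
    rw [this, hσ.2, mul_one, mul_inv_cancel]
  · intro σ hσ
    rw [hΦ.mem_invols] at hσ ⊢
    refine ⟨mul_mem (mul_mem hw' hσ.1) hw, ?_⟩
    have : w⁻¹ * σ * w * (w⁻¹ * σ * w) = w⁻¹ * (σ * σ) * w := by group
    rw [this, hσ.2, mul_one, inv_mul_cancel]
  · intro σ _
    group
  · intro σ _
    group
  · intro σ _
    rw [summand, summand, finrank_fixSpace_conj (hΦ.apply_mem hw) (hΦ.apply_mem hw')]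
    congr 1
    refine Finset.prod_nbij' (fun b => w b) (fun b => w⁻¹ b) ?_ ?_ (fun b _ => w.symm_apply_apply b)
      (fun b _ => w.apply_symm_apply b) fun b _ => (factor_apply w σ L x b).symm
    · intro b hb
      rw [mem_pos] at hb ⊢
      exact ⟨hΦ.apply_mem hw b hb.1, by rw [LinearIsometryEquiv.inner_map_map]; exact hb.2⟩
    · intro b hb
      rw [mem_pos] at hb ⊢
      exact ⟨hΦ.apply_mem hw' b hb.1, by rw [inner_inv_left]; exact hb.2⟩

/-- The product of the signs of the positive members of `B` is anti-invariant under the reflection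
in a member of `B`. -/
theorem prod_sg_refl {B : Finset E} (hBΦ : B ⊆ Φ) (hB : ∀ b ∈ B, -b ∈ B) {a : E} (ha : a ∈ B)
    (hs : ∀ b ∈ B, refl a b ∈ B) {L x : E} (hL : Regular B L) (hx : Regular B x) :
    ∏ b ∈ pos B L, sg ⟪b, refl a x⟫ = -∏ b ∈ pos B L, sg ⟪b, x⟫ := by
  classical
  wlog hax : 0 < ⟪a, x⟫ generalizing a
  · rw [← refl_neg]
    refine this (hB a ha) (fun b hb => by rw [refl_neg]; exact hs b hb) ?_
    rw [inner_neg_left]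
    exact neg_pos.2 (lt_of_le_of_ne (not_lt.1 hax) (hx a ha))
  have hsx : ∀ b, ⟪b, refl a x⟫ = ⟪refl a b, x⟫ := fun b => (inner_refl_left a b x).symm
  have key : ∏ b ∈ pos B L, sg (⟪b, x⟫ * ⟪refl a b, x⟫) = -1 := by
    rw [prod_pos_eq (L' := x) hB (fun b _ => by simp) hL hx]
    have e : ∏ b ∈ pos B x, sg (⟪b, x⟫ * ⟪refl a b, x⟫) = ∏ b ∈ pos B x, sg ⟪refl a b, x⟫ := by
      refine Finset.prod_congr rfl fun b hb => ?_
      rw [sg_mul, sg_of_pos (mem_pos.1 hb).2, one_mul]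
    rw [e, ← Finset.mul_prod_erase _ _ (mem_pos.2 ⟨ha, hax⟩)]
    have e1 : sg ⟪refl a a, x⟫ = -1 := by
      rw [refl_self, inner_neg_left, sg_of_neg (neg_neg_of_pos hax)]
    have e2 : ∏ b ∈ (pos B x).erase a, sg ⟪refl a b, x⟫ = 1 := by
      have hreg : ∀ b ∈ B, ⟪refl a b, x⟫ ≠ 0 := fun b hb => hx _ (hs b hb)
      refine Finset.prod_involution
        (fun b _ => if 0 < ⟪refl a b, x⟫ then refl a b else -refl a b) ?_ ?_ ?_ ?_
      · intro b hb
        have hb' := mem_pos.1 (Finset.mem_erase.1 hb).2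
        split_ifs with h
        · rw [refl_refl, sg_of_pos h, sg_of_pos hb'.2, one_mul]
        · have h' := lt_of_le_of_ne (not_lt.1 h) (hreg b hb'.1)
          rw [map_neg, refl_refl, inner_neg_left, sg_of_neg h', sg_of_neg (neg_neg_of_pos hb'.2)]
          norm_num
      · intro b hb h1 h2
        have hb' := mem_pos.1 (Finset.mem_erase.1 hb).2
        by_cases h : 0 < ⟪refl a b, x⟫
        · exact h1 (sg_of_pos h)
        · rw [if_neg h, refl_apply (hΦ.norm_one a (hBΦ ha))] at h2
          have h3 : b = ⟪a, b⟫ • a := by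
            have h4 : (2 : ℝ) • b = (2 : ℝ) • (⟪a, b⟫ • a) := by
              calc (2 : ℝ) • b = b + b := two_smul ℝ b
                _ = b + -(b - (2 * ⟪a, b⟫) • a) := by rw [h2]
                _ = _ := by module
            exact smul_right_injective E (two_ne_zero' ℝ) h4
          rcases eq_or_eq_neg_of_eq_smul (hΦ.norm_one a (hBΦ ha)) (hΦ.norm_one b (hBΦ hb'.1)) h3
            with h5 | h5
          · exact (Finset.mem_erase.1 hb).1 h5
          · rw [h5, inner_neg_left] at hb'
            linarith [hb'.2]
      · intro b hb
        obtain ⟨hba, hb'⟩ := Finset.mem_erase.1 hb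
        rw [mem_pos] at hb'
        rw [Finset.mem_erase, mem_pos]
        split_ifs with h
        · refine ⟨fun h' => ?_, hs b hb'.1, h⟩
          have h3 : b = -a := by rw [← refl_refl a b, h', refl_self]
          rw [h3, inner_neg_left] at hb'
          linarith [hb'.2]
        · refine ⟨fun h' => hba ?_, hB _ (hs b hb'.1), ?_⟩
          · rw [← refl_refl a b, ← neg_neg (refl a b), h', map_neg, refl_self, neg_neg]
          · rw [inner_neg_left]
            exact neg_pos.2 (lt_of_le_of_ne (not_lt.1 h) (hreg b hb'.1))
      · intro b hb
        have hb' := (mem_pos.1 (Finset.mem_erase.1 hb).2).2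
        by_cases h : 0 < ⟪refl a b, x⟫
        · simp [h, refl_refl, hb']
        · simp [h, refl_refl, hb'.le]
    rw [e1, e2, mul_one]
  simp only [sg_mul, Finset.prod_mul_distrib] at key
  have hsq : (∏ b ∈ pos B L, sg ⟪b, x⟫) * (∏ b ∈ pos B L, sg ⟪b, x⟫) = 1 := by
    rw [← Finset.prod_mul_distrib]
    exact Finset.prod_eq_one fun b hb => sg_mul_self (hx b (mem_pos.1 hb).1)
  simp only [hsx]
  linear_combination (∏ b ∈ pos B L, sg ⟪b, x⟫) * key - (∏ b ∈ pos B L, sg ⟪refl a b, x⟫) * hsq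

variable {Ω : Type*} [Fintype Ω]

theorem sum_prod_sg_eq_zero {B : Finset E} (hBΦ : B ⊆ Φ) (hB : ∀ b ∈ B, -b ∈ B) {a : E}
    (ha : a ∈ B) (hs : ∀ b ∈ B, refl a b ∈ B) {L : E} (hL : Regular Φ L) {ξ : Ω → E}
    (hξ : ∀ w, Regular Φ (ξ w)) (r : Ω ≃ Ω) (hr : ∀ w, ξ (r w) = refl a (ξ w)) :
    ∑ w, ∏ b ∈ pos B L, sg ⟪b, ξ w⟫ = 0 := by
  have h : ∑ w, ∏ b ∈ pos B L, sg ⟪b, ξ w⟫ = -∑ w, ∏ b ∈ pos B L, sg ⟪b, ξ w⟫ := by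
    rw [← Finset.sum_neg_distrib]
    conv_lhs => rw [← Equiv.sum_comp r]
    refine Finset.sum_congr rfl fun w _ => ?_
    rw [hr, hΦ.prod_sg_refl hBΦ hB ha hs (fun b hb => hL b (hBΦ hb))
      fun b hb => hξ w b (hBΦ hb)]
  exact self_eq_neg.1 h

omit hΦ in
theorem apply_refl_comm {σ : E ≃ₗᵢ[ℝ] E} {a : E} (ha1 : ‖a‖ = 1) (h : σ a = a ∨ σ a = -a) (b : E) :
    σ (refl a b) = refl a (σ b) := by
  have h1 := mul_refl_mul_inv σ ha1
  have h3 : refl (σ a) = refl a := by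
    rcases h with h | h <;> rw [h]
    exact refl_neg a
  rw [h3] at h1
  have h4 : σ * refl a = refl a * σ := by
    conv_rhs => rw [← h1]
    group
  exact congrArg (fun u : E ≃ₗᵢ[ℝ] E => u b) h4

/-- The sum of the formula over an orbit: only the involution `-1` contributes, since any other
involution fixes some root, and the reflection in that root reverses the sign of its summand. -/
theorem sum_formula (hn : HasNeg Φ) {L : E} (hL : Regular Φ L) {ξ : Ω → E}
    (hξ : ∀ w, Regular Φ (ξ w))
    (hr : ∀ a ∈ Φ, ∃ r : Ω ≃ Ω, ∀ w, ξ (r w) = refl a (ξ w)) :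
    ∑ w, formula Φ L (ξ w) = Fintype.card Ω := by
  classical
  obtain ⟨w₀, hw₀, hneg⟩ := hn
  have hw2 : w₀ * w₀ = 1 := by
    refine hΦ.ext_on (mul_mem hw₀ hw₀) (one_mem _) fun b hb => ?_
    change w₀ (w₀ b) = b
    rw [hneg b hb, map_neg, hneg b hb, neg_neg]
  simp only [formula]
  rw [Finset.sum_comm, Finset.sum_eq_single w₀]
  · have e1 : fixSpace Φ w₀ = ⊥ := by
      rw [eq_bot_iff]
      intro x hx
      obtain ⟨h1, h2⟩ := mem_fixSpace.1 hx
      have h : Set.EqOn w₀.toLinearEquiv.toLinearMap (-LinearMap.id : E →ₗ[ℝ] E) (Φ : Set E) :=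
        fun b hb => hneg b hb
      have h3 : w₀ x = -x := LinearMap.eqOn_span h h1
      rw [h2] at h3
      exact (Submodule.mem_bot ℝ).2 (by
        have h4 := eq_neg_iff_add_eq_zero.1 h3
        rw [← two_smul ℝ] at h4
        simpa using h4)
    have e2 : ∀ w, summand Φ L (ξ w) w₀ = 1 := by
      intro w
      rw [summand, e1, finrank_bot, pow_zero, one_mul]
      refine Finset.prod_eq_one fun b hb => ?_
      rw [factor, if_pos (hneg b (mem_pos.1 hb).1)]
    simp [e2]
  · intro σ hσ hne
    obtain ⟨hσW, hσ2⟩ := hΦ.mem_invols.1 hσ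
    have hσσ := apply_apply_of_mul_self hσ2
    have hmem := mul_mem hw₀ hσW
    have hsq : (w₀ * σ) * (w₀ * σ) = 1 := by
      refine hΦ.ext_on (mul_mem hmem hmem) (one_mem _) fun b hb => ?_
      change w₀ (σ (w₀ (σ b))) = b
      rw [hneg _ (hΦ.apply_mem hσW b hb), map_neg, hσσ, map_neg, hneg b hb, neg_neg]
    have hne1 : w₀ * σ ≠ 1 := by
      intro h
      apply hne
      rw [← mul_left_cancel (h.trans hw2.symm)]
    obtain ⟨a, ha, hwa⟩ := hΦ.exists_apply_eq_neg hmem hsq hne1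
    have hσa : σ a = a := by
      have h1 : w₀ (σ a) = -a := hwa
      rw [hneg _ (hΦ.apply_mem hσW a ha)] at h1
      exact neg_injective h1
    obtain ⟨r, hr⟩ := hr a ha
    simp only [summand_eq Φ L (ξ _) σ]
    rw [← Finset.mul_sum, hΦ.sum_prod_sg_eq_zero (Finset.filter_subset _ _) ?_ (a := a) ?_ ?_ hL hξ
      r hr, mul_zero]
    · intro b hb
      rw [Finset.mem_filter] at hb ⊢
      refine ⟨hΦ.neg_mem hb.1, fun h => hb.2 ?_⟩
      rw [map_neg] at h
      exact neg_injective h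
    · rw [Finset.mem_filter, hσa]
      exact ⟨ha, hΦ.self_ne_neg ha⟩
    · intro b hb
      rw [Finset.mem_filter] at hb ⊢
      refine ⟨hΦ.refl_mem a ha b hb.1, fun h => hb.2 ?_⟩
      rw [apply_refl_comm (hΦ.norm_one a ha) (Or.inl hσa), ← map_neg] at h
      exact (refl a).injective h
  · intro h
    exact absurd (hΦ.mem_invols.2 ⟨hw₀, hw2⟩) h

/-- The alternating sum of the formula over an orbit: only the trivial involution contributes,
since any other involution negates some root. -/
theorem sum_sign_mul_formula {L : E} (hL : Regular Φ L) {ξ : Ω → E}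
    (hξ : ∀ w, Regular Φ (ξ w))
    (hr : ∀ a ∈ Φ, ∃ r : Ω ≃ Ω, ∀ w, ξ (r w) = refl a (ξ w)) :
    ∑ w, (∏ b ∈ pos Φ L, sg ⟪b, ξ w⟫) * formula Φ L (ξ w)
      = Complex.I ^ ((pos Φ L).card + finrank ℝ (Submodule.span ℝ (Φ : Set E))) *
        Fintype.card Ω := by
  classical
  simp only [formula, Finset.mul_sum]
  rw [Finset.sum_comm]
  have key : ∀ σ w, (∏ b ∈ pos Φ L, sg ⟪b, ξ w⟫) * summand Φ L (ξ w) σ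
      = summand Φ L L σ * ∏ b ∈ pos (Φ.filter fun b => σ b = -b) L, sg ⟪b, ξ w⟫ := by
    intro σ w
    have e : pos (Φ.filter fun b => σ b = -b) L = (pos Φ L).filter fun b => σ b = -b := by
      ext b
      simp only [mem_pos, Finset.mem_filter]
      tauto
    have e' : pos (Φ.filter fun b => σ b ≠ -b) L = (pos Φ L).filter fun b => ¬ σ b = -b := by
      ext b
      simp only [mem_pos, Finset.mem_filter]
      tauto
    have hsq : (∏ b ∈ (pos Φ L).filter fun b => ¬ σ b = -b, sg ⟪b, ξ w⟫) *
        (∏ b ∈ (pos Φ L).filter fun b => ¬ σ b = -b, sg ⟪b, ξ w⟫) = 1 := by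
      rw [← Finset.prod_mul_distrib]
      exact Finset.prod_eq_one fun b hb =>
        sg_mul_self (hξ w b (mem_pos.1 (Finset.mem_filter.1 hb).1).1)
    rw [summand_eq, e, e', ← Finset.prod_filter_mul_prod_filter_not (pos Φ L) (fun b => σ b = -b)]
    linear_combination ((∏ b ∈ (pos Φ L).filter fun b => σ b = -b, sg ⟪b, ξ w⟫) *
      summand Φ L L σ) * hsq
  simp only [key, ← Finset.mul_sum]
  rw [Finset.sum_eq_single 1]
  · have e1 : pos (Φ.filter fun b => (1 : E ≃ₗᵢ[ℝ] E) b = -b) L = ∅ := by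
      rw [Finset.eq_empty_iff_forall_notMem]
      intro b hb
      rw [mem_pos, Finset.mem_filter] at hb
      exact hΦ.self_ne_neg hb.1.1 hb.1.2
    have e2 : fixSpace Φ 1 = Submodule.span ℝ (Φ : Set E) := by
      ext x
      rw [mem_fixSpace]
      exact and_iff_left rfl
    have e3 : summand Φ L L 1
        = Complex.I ^ ((pos Φ L).card + finrank ℝ (Submodule.span ℝ (Φ : Set E))) := by
      rw [summand, e2, pow_add, mul_comm, ← Finset.prod_const]
      congr 1
      refine Finset.prod_congr rfl fun b hb => ?_
      rw [mem_pos] at hb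
      have h1 : (1 : E ≃ₗᵢ[ℝ] E) b = b := rfl
      have h2 : (1 : E ≃ₗᵢ[ℝ] E) b ≠ -b := hΦ.self_ne_neg hb.1
      rw [factor, if_neg h2, if_pos (Or.inr h1), sg_of_pos (mul_pos hb.2 hb.2), one_mul]
    rw [e1, e3]
    simp
  · intro σ hσ hne
    obtain ⟨hσW, hσ2⟩ := hΦ.mem_invols.1 hσ
    obtain ⟨a, ha, hσa⟩ := hΦ.exists_apply_eq_neg hσW hσ2 hne
    obtain ⟨r, hr⟩ := hr a ha
    rw [hΦ.sum_prod_sg_eq_zero (Finset.filter_subset _ _) ?_ (a := a) ?_ ?_ hL hξ r hr, mul_zero]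
    · intro b hb
      rw [Finset.mem_filter] at hb ⊢
      exact ⟨hΦ.neg_mem hb.1, by rw [map_neg, hb.2]⟩
    · rw [Finset.mem_filter]
      exact ⟨ha, hσa⟩
    · intro b hb
      rw [Finset.mem_filter] at hb ⊢
      refine ⟨hΦ.refl_mem a ha b hb.1, ?_⟩
      rw [apply_refl_comm (hΦ.norm_one a ha) (Or.inr hσa), hb.2, map_neg]
  · intro h
    exact absurd (hΦ.mem_invols.2 ⟨one_mem _, one_mul _⟩) h

end IsUnitSystem

end UnitSystem

/-! ### Euclidean model of a root system -/

section Euclidean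

variable {ι V X : Type*} [Fintype ι] [AddCommGroup V] [Module ℝ V] [AddCommGroup X] [Module ℝ X]

/-- The map which sends `x` to the family of the values of the roots at `x`. It pulls the
Euclidean structure back to a Weyl-invariant one on `X`. -/
def emb (P : RootPairing ι ℝ V X) : X →ₗ[ℝ] EuclideanSpace ℝ ι :=
  (WithLp.linearEquiv 2 ℝ (ι → ℝ)).symm.toLinearMap ∘ₗ LinearMap.pi P.root'

variable (P : RootPairing ι ℝ V X)

omit [Fintype ι] in
theorem emb_apply (x : X) (i : ι) : emb P x i = P.root' i x := rfl

theorem inner_emb (x y : X) : ⟪emb P x, emb P y⟫ = P.CorootForm x y := by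
  rw [P.corootForm_apply_apply, PiLp.inner_apply]
  refine Finset.sum_congr rfl fun i _ => ?_
  simp [emb_apply, mul_comm]

omit [Fintype ι] in
theorem emb_injective [P.IsRootSystem] : Function.Injective (emb P) := by
  rw [injective_iff_map_eq_zero]
  intro x hx
  have h0 : P.toLinearMap.flip x = 0 := by
    refine LinearMap.ext_on_range (v := P.root) RootPairing.IsRootSystem.span_root_eq_top fun i => ?_
    have : emb P x i = 0 := by rw [hx]; rfl
    exact this
  exact (LinearMap.IsPerfPair.bijective_right P.toLinearMap).injective (by rw [h0, map_zero])

theorem finiteDimensional_of_isRootSystem [P.IsRootSystem] : FiniteDimensional ℝ X :=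
  FiniteDimensional.of_injective (emb P) (emb_injective P)

theorem norm_emb_coroot_pos [P.IsRootSystem] (j : ι) : 0 < ‖emb P (P.coroot j)‖ := by
  rw [norm_pos_iff]
  exact fun h => P.ne_zero' j ((injective_iff_map_eq_zero _).1 (emb_injective P) _ h)

/-- The coroot `j` in the Euclidean model, normalized to length one. -/
def unitCoroot (j : ι) : EuclideanSpace ℝ ι :=
  ‖emb P (P.coroot j)‖⁻¹ • emb P (P.coroot j)

theorem norm_unitCoroot [P.IsRootSystem] (j : ι) : ‖unitCoroot P j‖ = 1 := by
  have := norm_emb_coroot_pos P j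
  rw [unitCoroot, norm_smul, norm_inv, norm_norm, inv_mul_cancel₀ this.ne']

theorem inner_unitCoroot [P.IsRootSystem] (j : ι) (x : X) :
    ⟪unitCoroot P j, emb P x⟫ = ‖emb P (P.coroot j)‖ / 2 * P.root' j x := by
  have h1 := congrArg (fun v => P.toLinearMap v x) (P.corootForm_self_smul_root j)
  simp only [map_smul, LinearMap.smul_apply, smul_eq_mul, map_nsmul] at h1
  rw [P.toLinearMap_apply_CoPolarization, ← inner_emb, ← inner_emb, real_inner_self_eq_norm_sq,
    nsmul_eq_mul] at h1
  have h2 := norm_emb_coroot_pos P j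
  rw [unitCoroot, inner_smul_left]
  have h3 : P.toLinearMap (P.root j) x = P.root' j x := rfl
  rw [h3] at h1
  simp only [conj_trivial]
  field_simp
  push_cast at h1
  linarith

theorem inner_unitCoroot_pos [P.IsRootSystem] {j : ι} {x : X} :
    0 < ⟪unitCoroot P j, emb P x⟫ ↔ 0 < P.root' j x := by
  rw [inner_unitCoroot]
  exact mul_pos_iff_of_pos_left (half_pos (norm_emb_coroot_pos P j))

theorem inner_unitCoroot_ne_zero [P.IsRootSystem] {j : ι} {x : X} :
    ⟪unitCoroot P j, emb P x⟫ ≠ 0 ↔ P.root' j x ≠ 0 := by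
  rw [inner_unitCoroot, mul_ne_zero_iff]
  exact and_iff_right (half_pos (norm_emb_coroot_pos P j)).ne'

theorem inner_unitCoroot_mul_pos [P.IsRootSystem] {j : ι} {x y : X} :
    0 < ⟪unitCoroot P j, emb P x⟫ * ⟪unitCoroot P j, emb P y⟫ ↔
      0 < P.root' j x * P.root' j y := by
  rw [inner_unitCoroot, inner_unitCoroot, mul_mul_mul_comm]
  exact mul_pos_iff_of_pos_left (mul_self_pos.2 (half_pos (norm_emb_coroot_pos P j)).ne')

theorem inner_unitCoroot_mul_neg [P.IsRootSystem] {j : ι} {x y : X} :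
    ⟪unitCoroot P j, emb P x⟫ * ⟪unitCoroot P j, emb P y⟫ < 0 ↔
      P.root' j x * P.root' j y < 0 := by
  rw [inner_unitCoroot, inner_unitCoroot, mul_mul_mul_comm]
  have hc := mul_self_pos.2 (half_pos (norm_emb_coroot_pos P j)).ne'
  exact ⟨fun h => by
    by_contra! h'
    exact (mul_nonneg hc.le h').not_gt h, mul_neg_of_pos_of_neg hc⟩

theorem refl_unitCoroot_emb [P.IsRootSystem] (j : ι) (x : X) :
    refl (unitCoroot P j) (emb P x) = emb P (P.coreflection j x) := by
  have h2 := norm_emb_coroot_pos P j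
  rw [refl_apply (norm_unitCoroot P j), inner_unitCoroot, P.coreflection_apply, map_sub, map_smul,
    unitCoroot, smul_smul]
  congr 2
  field_simp

theorem refl_unitCoroot_unitCoroot [P.IsRootSystem] (i j : ι) :
    refl (unitCoroot P i) (unitCoroot P j) = unitCoroot P (P.reflectionPerm i j) := by
  rw [unitCoroot.eq_def P j, map_smul, refl_unitCoroot_emb,
    unitCoroot.eq_def P (P.reflectionPerm i j),
    P.coroot_reflectionPerm, ← refl_unitCoroot_emb, LinearIsometryEquiv.norm_map]

theorem unitCoroot_eq_or_eq_neg [P.IsRootSystem] {i j : ι} :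
    P.root j ∈ Submodule.span ℝ {P.root i} ↔
      unitCoroot P j = unitCoroot P i ∨ unitCoroot P j = -unitCoroot P i := by
  constructor
  · intro h
    obtain ⟨c, hc⟩ := Submodule.mem_span_singleton.1 h
    have hj := norm_emb_coroot_pos P j
    have hi := norm_emb_coroot_pos P i
    set d := ‖emb P (P.coroot j)‖ / 2 * c / (‖emb P (P.coroot i)‖ / 2) with hd
    refine eq_or_eq_neg_of_eq_smul (norm_unitCoroot P i) (norm_unitCoroot P j) (c := d) ?_
    have key : ∀ x, ⟪unitCoroot P j - d • unitCoroot P i, emb P x⟫ = 0 := by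
      intro x
      have h1 : P.root' j x = c * P.root' i x := by
        change P.toLinearMap (P.root j) x = c * P.toLinearMap (P.root i) x
        rw [← hc]
        simp
      rw [inner_sub_left, inner_smul_left, inner_unitCoroot, inner_unitCoroot, h1, hd]
      simp only [conj_trivial]
      field_simp
      ring
    have hrange : unitCoroot P j - d • unitCoroot P i ∈ LinearMap.range (emb P) :=
      Submodule.sub_mem _ (Submodule.smul_mem _ _ ⟨_, rfl⟩)
        (Submodule.smul_mem _ _ (Submodule.smul_mem _ _ ⟨_, rfl⟩))
    obtain ⟨x, hx⟩ := hrange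
    have h0 := key x
    rw [hx, inner_self_eq_zero] at h0
    exact sub_eq_zero.1 h0
  · intro h
    have hj := norm_emb_coroot_pos P j
    have hi := norm_emb_coroot_pos P i
    have key : ∃ c : ℝ, ∀ x, P.root' j x = c * P.root' i x := by
      rcases h with h | h
      · refine ⟨(‖emb P (P.coroot i)‖ / 2) / (‖emb P (P.coroot j)‖ / 2), fun x => ?_⟩
        have := inner_unitCoroot P j x
        rw [h, inner_unitCoroot] at this
        field_simp at this ⊢
        linarith
      · refine ⟨-((‖emb P (P.coroot i)‖ / 2) / (‖emb P (P.coroot j)‖ / 2)), fun x => ?_⟩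
        have := inner_unitCoroot P j x
        rw [h, inner_neg_left, inner_unitCoroot] at this
        field_simp at this ⊢
        linarith
    obtain ⟨c, hc⟩ := key
    rw [Submodule.mem_span_singleton]
    refine ⟨c, (LinearMap.IsPerfPair.bijective_left P.toLinearMap).injective ?_⟩
    ext x
    rw [map_smul]
    exact (hc x).symm

/-- The unit coroots of the roots in `S`. -/
def unitSystem (S : Set ι) : Finset (EuclideanSpace ℝ ι) :=
  open Classical in (Set.toFinite S).toFinset.image (unitCoroot P)

theorem mem_unitSystem {S : Set ι} {b : EuclideanSpace ℝ ι} :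
    b ∈ unitSystem P S ↔ ∃ j ∈ S, unitCoroot P j = b := by
  simp [unitSystem]

/-- A set of roots which is closed under its reflections. -/
def ReflClosed (S : Set ι) : Prop := ∀ i ∈ S, ∀ j ∈ S, P.reflectionPerm i j ∈ S

variable {P}

theorem ReflClosed.isUnitSystem [P.IsRootSystem] {S : Set ι} (hS : ReflClosed P S) :
    IsUnitSystem (unitSystem P S) where
  norm_one a ha := by
    obtain ⟨j, -, rfl⟩ := (mem_unitSystem P).1 ha
    exact norm_unitCoroot P j
  refl_mem a ha b hb := by
    obtain ⟨i, hi, rfl⟩ := (mem_unitSystem P).1 ha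
    obtain ⟨j, hj, rfl⟩ := (mem_unitSystem P).1 hb
    exact (mem_unitSystem P).2 ⟨_, hS i hi j hj, (refl_unitCoroot_unitCoroot P i j).symm⟩

omit [Fintype ι] in
theorem ReflClosed.wallRoots {S : Set ι} (hS : ReflClosed P S) (i : ι) :
    ReflClosed P (wallRoots P S i) := by
  rintro j ⟨hj, hj0⟩ k ⟨hk, hk0⟩
  refine ⟨hS j hj k hk, ?_⟩
  rw [P.coroot_reflectionPerm, P.coreflection_apply, map_sub, map_smul, hj0, hk0]
  simp

theorem unitSystem_wallRoots [P.IsRootSystem] (S : Set ι) (i : ι) :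
    unitSystem P (wallRoots P S i) = perp (unitSystem P S) (unitCoroot P i) := by
  have key : ∀ j, ⟪unitCoroot P j, unitCoroot P i⟫ = 0 ↔ P.root' i (P.coroot j) = 0 := by
    intro j
    have h2 := norm_emb_coroot_pos P j
    have h3 := norm_emb_coroot_pos P i
    rw [real_inner_comm]
    conv_lhs => rw [unitCoroot.eq_def P j, inner_smul_right, inner_unitCoroot]
    simp [h2.ne', h3.ne', -norm_eq_zero]
  ext b
  rw [mem_perp, mem_unitSystem, mem_unitSystem]
  constructor
  · rintro ⟨j, hj, rfl⟩
    exact ⟨⟨j, hj.1, rfl⟩, (key j).2 hj.2⟩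
  · rintro ⟨⟨j, hj, rfl⟩, h⟩
    exact ⟨j, ⟨hj, (key j).1 h⟩, rfl⟩

theorem unitSystem_empty : unitSystem P ∅ = ∅ := by
  ext; simp [mem_unitSystem]

omit [Fintype ι] in
theorem reflClosed_univ : ReflClosed P Set.univ := fun _ _ _ _ => trivial

/-! ### The rules determine the value of the formula -/

/-- Every value which the rules give is the value of the formula. -/
theorem IsStableConst.eq_formula [P.IsRootSystem] {lam : V} {z : X}
    (hz : ∀ j, 0 < P.coroot' j lam * P.root' j z) {S : Set ι} {x : X} {n : ℤ}
    (h : IsStableConst P lam S x n) (hS : ReflClosed P S) (hn : HasNeg (unitSystem P S)) :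
    (n : ℂ) = formula (unitSystem P S) (emb P z) (emb P x) := by
  have hreg : ∀ S : Set ι, Regular (unitSystem P S) (emb P z) := by
    intro S b hb
    obtain ⟨j, -, rfl⟩ := (mem_unitSystem P).1 hb
    exact (inner_unitCoroot_ne_zero P).2 (right_ne_zero_of_mul (hz j).ne')
  induction h with
  | rank_zero S x hS0 =>
    subst hS0
    rw [unitSystem_empty, formula_empty, Int.cast_one]
  | vanishing S x hne hpos =>
    obtain ⟨j, hj⟩ := hne
    rw [formula_congr (y := emb P z), hS.isUnitSystem.formula_self_eq_zero hn (hreg S)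
      ⟨_, (mem_unitSystem P).2 ⟨j, hj, rfl⟩⟩, Int.cast_zero]
    intro b hb
    obtain ⟨j, hj, rfl⟩ := (mem_unitSystem P).1 hb
    rw [inner_unitCoroot_mul_pos]
    have h1 := mul_pos (hpos j hj) (hz j)
    have h2 := sq_pos_of_ne_zero (left_ne_zero_of_mul (hz j).ne')
    by_contra! h3
    nlinarith
  | wall_crossing S i hi x x' y hface a b ha hb iha ihb =>
    have hmem : unitCoroot P i ∈ unitSystem P S := (mem_unitSystem P).2 ⟨i, hi, rfl⟩
    have e1 := iha (hS.wallRoots i) (by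
      rw [unitSystem_wallRoots]
      exact hS.isUnitSystem.hasNeg_perp hn hmem)
    have e2 := ihb hS hn
    rw [unitSystem_wallRoots] at e1
    have e3 := hS.isUnitSystem.formula_add hn (hreg S) hmem (x := emb P x) (x' := emb P x')
      (y := emb P y) (by rw [inner_unitCoroot, hface.1, mul_zero])
      ((inner_unitCoroot_mul_neg P).2
        ((hface.2 i hi).1 (Submodule.mem_span_singleton_self _))) (by
        intro b hb h1 h2
        obtain ⟨j, hj, rfl⟩ := (mem_unitSystem P).1 hb
        rw [inner_unitCoroot_mul_pos, inner_unitCoroot_mul_pos]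
        refine (hface.2 j hj).2 fun hm => ?_
        rcases (unitCoroot_eq_or_eq_neg P).1 hm with h | h
        exacts [h1 h, h2 h])
    push_cast
    rw [e1, e2]
    linear_combination -e3

omit [Fintype ι] in
/-- The rules give a value for every regular `x`, by induction on the number of roots and on the
number of hyperplanes which separate `x` from the chamber dual to `lam`. -/
theorem exists_isStableConst [Finite ι] {lam : V} {z : X}
    (hz : ∀ j, 0 < P.coroot' j lam * P.root' j z) :
    ∀ (S : Set ι) (x : X), (∀ j ∈ S, P.root' j x ≠ 0) → ∃ n, IsStableConst P lam S x n := by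
  intro S
  induction hN : S.ncard using Nat.strong_induction_on generalizing S with
  | _ N ihN =>
    intro x
    induction hM : {j | j ∈ S ∧ P.root' j x * P.root' j z < 0}.ncard using
      Nat.strong_induction_on generalizing x with
    | _ M ihM =>
      intro hx
      rcases S.eq_empty_or_nonempty with hS | hS
      · exact ⟨1, .rank_zero S x hS⟩
      by_cases hsep : ∃ j ∈ S, P.root' j x * P.root' j z < 0
      · have hspan : ∀ i j, P.root' j ∈ Submodule.span ℝ {P.root' i} ↔
            P.root j ∈ Submodule.span ℝ {P.root i} := by
          intro i j
          rw [Submodule.mem_span_singleton, Submodule.mem_span_singleton]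
          refine exists_congr fun c => ⟨fun h => ?_, fun h => ?_⟩
          · refine (LinearMap.IsPerfPair.bijective_left P.toLinearMap).injective ?_
            rw [map_smul]
            exact h
          · have := congrArg P.toLinearMap h
            rw [map_smul] at this
            exact this
        obtain ⟨i, hi, his, x', y, hy, hall⟩ := exists_separating_wall (Set.toFinite S) P.root' hx
          (fun j _ => right_ne_zero_of_mul (hz j).ne') hsep
        simp only [hspan] at hall
        have hlt : (wallRoots P S i).ncard < N := by
          rw [← hN]
          refine Set.ncard_lt_ncard ⟨fun j hj => hj.1, fun h => ?_⟩ (Set.toFinite S)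
          have := (h hi).2
          rw [P.root'_coroot_eq_pairing, P.pairing_same] at this
          exact two_ne_zero this
        obtain ⟨a, ha⟩ := ihN _ hlt _ rfl y (by
          rintro j ⟨hj, hji⟩
          refine right_ne_zero_of_mul ((hall j hj).2 fun h => ?_).1.ne'
          obtain ⟨c, hc⟩ := Submodule.mem_span_singleton.1 h
          have h1 : P.root' j (P.coroot j) = c * P.root' i (P.coroot j) := by
            change P.toLinearMap (P.root j) _ = c * P.toLinearMap (P.root i) _
            rw [← hc]
            simp
          rw [hji, P.root'_coroot_eq_pairing, P.pairing_same, mul_zero] at h1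
          exact two_ne_zero h1)
        have hlt' : {j | j ∈ S ∧ P.root' j x' * P.root' j z < 0}.ncard < M := by
          rw [← hM]
          refine Set.ncard_lt_ncard ?_ (Set.toFinite _)
          have hnot : ∀ j ∈ S, P.root j ∈ Submodule.span ℝ {P.root i} →
              ¬ P.root' j x' * P.root' j z < 0 := by
            intro j hj hm h
            have h1 := (hall j hj).1 hm
            obtain ⟨c, hc⟩ := Submodule.mem_span_singleton.1 hm
            have h2 : ∀ u, P.root' j u = c * P.root' i u := fun u => by
              change P.toLinearMap (P.root j) _ = c * P.toLinearMap (P.root i) _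
              rw [← hc]
              simp
            have h3 : P.root' j x * P.root' j z < 0 := by
              have hc0 : c ≠ 0 := by
                rintro rfl
                rw [h2 x', zero_mul, zero_mul] at h
                exact lt_irrefl _ h
              rw [h2 x, h2 z, mul_mul_mul_comm]
              exact mul_neg_of_pos_of_neg (mul_self_pos.2 hc0) his
            have h4 := mul_pos_of_neg_of_neg h1 h3
            have h5 := sq_pos_of_ne_zero (left_ne_zero_of_mul h3.ne)
            have h6 : 0 < P.root' j x' * P.root' j z := by
              by_contra! h7
              nlinarith
            exact h6.not_gt h
          refine ⟨fun j hj => ⟨hj.1, ?_⟩, fun h => ?_⟩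
          · have h1 := (hall j hj.1).2 fun hm => hnot j hj.1 hm hj.2
            have h2 := mul_pos h1.1 h1.2
            have h3 := sq_pos_of_ne_zero (right_ne_zero_of_mul h1.1.ne')
            have h4 : 0 < P.root' j x * P.root' j x' := by
              by_contra! h5
              nlinarith
            have h5 := mul_neg_of_pos_of_neg h4 hj.2
            have h6 := sq_pos_of_ne_zero (right_ne_zero_of_mul h4.ne')
            by_contra! h7
            nlinarith
          · exact hnot i hi (Submodule.mem_span_singleton_self _) (h ⟨hi, his⟩).2
        obtain ⟨b, hb⟩ := ihM _ hlt' x' rfl (by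
          intro j hj
          by_cases hm : P.root j ∈ Submodule.span ℝ {P.root i}
          · exact right_ne_zero_of_mul ((hall j hj).1 hm).ne
          · exact left_ne_zero_of_mul ((hall j hj).2 hm).2.ne')
        exact ⟨2 * a - b, .wall_crossing S i hi x x' y ⟨hy, hall⟩ a b ha hb⟩
      · push Not at hsep
        refine ⟨0, .vanishing S x hS fun j hj => ?_⟩
        have h1 : 0 < P.root' j x * P.root' j z :=
          lt_of_le_of_ne (hsep j hj) (mul_ne_zero (hx j hj)
            (right_ne_zero_of_mul (hz j).ne')).symm
        have h2 := mul_pos h1 (hz j)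
        have h3 := sq_pos_of_ne_zero (right_ne_zero_of_mul h1.ne')
        by_contra! h4
        nlinarith

end Euclidean

/-! ### The Weyl group in the Euclidean model -/

section WeylGroup

variable {ι V X : Type*} [AddCommGroup V] [Module ℝ V] [AddCommGroup X] [Module ℝ X]
  (P : RootPairing ι ℝ V X)

theorem act_eq_of_forall {w : P.Aut} {x y : X}
    (h : ∀ v, P.toLinearMap (w • v) y = P.toLinearMap v x) : act P w x = y := by
  refine (LinearMap.IsPerfPair.bijective_right P.toLinearMap).injective ?_
  ext v
  have h1 := toLinearMap_smul_act P w (w⁻¹ • v) x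
  rw [← h, smul_inv_smul] at h1
  exact h1

theorem act_mul (w w' : P.Aut) (x : X) : act P (w * w') x = act P w (act P w' x) :=
  act_eq_of_forall P fun v => by rw [mul_smul, toLinearMap_smul_act, toLinearMap_smul_act]

theorem act_one (x : X) : act P 1 x = x :=
  act_eq_of_forall P fun v => by rw [one_smul]

theorem eps_mul (w w' : P.Aut) : eps P (w * w') = eps P w * eps P w' := by
  rw [eps, eps, eps, ← LinearMap.det_comp]
  congr 1
  ext x
  exact act_mul P w w' x

theorem eps_one : eps P 1 = 1 := by
  rw [eps, ← LinearMap.det_id (M := X) (A := ℝ)]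
  congr 1
  ext x
  exact act_one P x

theorem eps_reflection [FiniteDimensional ℝ X] (i : ι) :
    eps P (RootPairing.Equiv.reflection P i) = -1 := by
  have h : ((act P (RootPairing.Equiv.reflection P i) : X ≃ₗ[ℝ] X) : X →ₗ[ℝ] X)
      = LinearMap.transvection (P.root' i) (-P.coroot i) := by
    ext x
    rw [act_reflection, LinearMap.transvection.apply]
    simp [P.coreflection_apply, sub_eq_add_neg]
  rw [eps, h, LinearMap.transvection.det, map_neg, P.root'_coroot_eq_pairing, P.pairing_same]
  norm_num

theorem eps_mul_self [FiniteDimensional ℝ X] {w : P.Aut} (hw : w ∈ P.weylGroup) :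
    eps P w * eps P w = 1 := by
  induction hw using RootPairing.weylGroup.induction with
  | mem i => rw [eps_reflection]; norm_num
  | one => rw [eps_one, one_mul]
  | mul w w' hw hw' h h' => rw [eps_mul]; linear_combination h * (eps P w' * eps P w') + h'

theorem eps_inv [FiniteDimensional ℝ X] {w : P.Aut} (hw : w ∈ P.weylGroup) :
    eps P w⁻¹ = eps P w := by
  have h1 := eps_mul_self P hw
  have h2 : eps P w⁻¹ * eps P w = 1 := by rw [← eps_mul, inv_mul_cancel, eps_one]
  linear_combination eps P w * h2 - eps P w⁻¹ * h1

end WeylGroup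

variable {ι V X : Type*} [Fintype ι] [AddCommGroup V] [Module ℝ V] [AddCommGroup X] [Module ℝ X]
  (P : RootPairing ι ℝ V X) [P.IsRootSystem]

theorem exists_reflGroup_emb {w : P.Aut} (hw : w ∈ P.weylGroup) :
    ∃ u ∈ reflGroup (unitSystem P Set.univ), ∀ x, emb P (act P w x) = u (emb P x) := by
  induction hw using RootPairing.weylGroup.induction with
  | mem i =>
    refine ⟨refl (unitCoroot P i), refl_mem_reflGroup ((mem_unitSystem P).2 ⟨i, trivial, rfl⟩),
      fun x => ?_⟩
    rw [act_reflection, refl_unitCoroot_emb]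
  | one => exact ⟨1, one_mem _, fun x => by rw [act_one]; rfl⟩
  | mul w w' hw hw' h h' =>
    obtain ⟨u, hu, hu'⟩ := h
    obtain ⟨v, hv, hv'⟩ := h'
    exact ⟨u * v, mul_mem hu hv, fun x => by rw [act_mul, hu', hv']; rfl⟩

theorem hasNeg_unitSystem (hneg : NegOneMemWeyl P) : HasNeg (unitSystem P Set.univ) := by
  obtain ⟨w, hw, h⟩ := hneg
  obtain ⟨u, hu, hu'⟩ := exists_reflGroup_emb P hw
  refine ⟨u, hu, fun b hb => ?_⟩
  obtain ⟨j, -, rfl⟩ := (mem_unitSystem P).1 hb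
  rw [unitCoroot, map_smul, ← hu', h, map_neg, smul_neg]

theorem regular_emb {x : X} (hx : IsRegular P x) :
    Regular (unitSystem P Set.univ) (emb P x) := by
  intro b hb
  obtain ⟨j, -, rfl⟩ := (mem_unitSystem P).1 hb
  exact (inner_unitCoroot_ne_zero P).2 (hx j)

omit [Fintype ι] [P.IsRootSystem] in
theorem IsRegular.act {x : X} (hx : IsRegular P x) (w : P.Aut) : IsRegular P (act P w x) := by
  intro i h
  have h1 := toLinearMap_smul_act P w (w⁻¹ • P.root i) x
  rw [smul_inv_smul] at h1
  have h2 : P.toLinearMap (P.root i) (StableConstants.act P w x) = 0 := h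
  have h3 := RootPairing.Equiv.root_indexEquiv_eq_smul (P := P) i w⁻¹
  rw [h2, ← h3] at h1
  exact hx _ h1.symm

/-! ### The stable constants and their orbit sums -/

/-- The point `z` of `X` represents the linear form `lam` for the Weyl-invariant scalar product. -/
def Represents (lam : V) (z : X) : Prop := ∀ x, ⟪emb P z, emb P x⟫ = P.toLinearMap lam x

theorem exists_represents (lam : V) : ∃ z, Represents P lam z := by
  have := finiteDimensional_of_isRootSystem P
  have hinj : Function.Injective P.CorootForm := by
    rw [injective_iff_map_eq_zero]
    intro x hx
    have h : ⟪emb P x, emb P x⟫ = 0 := by rw [inner_emb, hx]; rfl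
    exact (injective_iff_map_eq_zero _).1 (emb_injective P) x (inner_self_eq_zero.1 h)
  obtain ⟨z, hz⟩ := (LinearMap.injective_iff_surjective_of_finrank_eq_finrank
    (Subspace.dual_finrank_eq (K := ℝ) (V := X)).symm).1 hinj (P.toLinearMap lam)
  exact ⟨z, fun x => by rw [inner_emb, hz]⟩

variable {P}

theorem Represents.coroot'_eq {lam : V} {z : X} (hz : Represents P lam z) (j : ι) :
    P.coroot' j lam = ‖emb P (P.coroot j)‖ ^ 2 / 2 * P.root' j z := by
  have h := norm_emb_coroot_pos P j
  have h1 : ⟪emb P (P.coroot j), emb P z⟫ = P.coroot' j lam := by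
    rw [real_inner_comm, hz]
    rfl
  have h2 := inner_unitCoroot P j z
  rw [unitCoroot, inner_smul_left, h1] at h2
  simp only [conj_trivial] at h2
  field_simp at h2
  linarith

theorem Represents.coroot'_pos {lam : V} {z : X} (hz : Represents P lam z) {j : ι} :
    0 < P.coroot' j lam ↔ 0 < P.root' j z := by
  rw [hz.coroot'_eq]
  exact mul_pos_iff_of_pos_left (by have := norm_emb_coroot_pos P j; positivity)

theorem Represents.mul_pos {lam : V} {z : X} (hz : Represents P lam z) (hlam : IsDualRegular P lam)
    (j : ι) : 0 < P.coroot' j lam * P.root' j z := by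
  have h := hz.coroot'_eq j
  have h0 := hlam j
  rw [h] at h0 ⊢
  have h1 := sq_pos_of_ne_zero (right_ne_zero_of_mul h0)
  have h2 := norm_emb_coroot_pos P j
  calc 0 < ‖emb P (P.coroot j)‖ ^ 2 / 2 * P.root' j z ^ 2 := by positivity
    _ = _ := by ring

theorem Represents.isRegular {lam : V} {z : X} (hz : Represents P lam z)
    (hlam : IsDualRegular P lam) : IsRegular P z := fun j =>
  right_ne_zero_of_mul (hz.mul_pos hlam j).ne'

theorem Represents.smul {lam : V} {z : X} (hz : Represents P lam z) {w : P.Aut}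
    (hw : w ∈ P.weylGroup) : Represents P (w • lam) (act P w z) := by
  obtain ⟨u, hu, hu'⟩ := exists_reflGroup_emb P hw
  intro x
  obtain ⟨x, rfl⟩ := (act P w).surjective x
  rw [hu', hu', LinearIsometryEquiv.inner_map_map, toLinearMap_smul_act]
  exact hz x

theorem IsDualRegular.smul {lam : V} (hlam : IsDualRegular P lam) {w : P.Aut}
    (hw : w ∈ P.weylGroup) : IsDualRegular P (w • lam) := by
  obtain ⟨z, hz⟩ := exists_represents P lam
  intro j
  rw [(hz.smul hw).coroot'_eq]
  have := norm_emb_coroot_pos P j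
  exact mul_ne_zero (by positivity) (IsRegular.act P (hz.isRegular hlam) w j)

theorem stableConst_eq (hneg : NegOneMemWeyl P) {lam : V} {z : X} (hz : Represents P lam z)
    (hlam : IsDualRegular P lam) {x : X} (hx : IsRegular P x) :
    (stableConst P x lam : ℂ) = formula (unitSystem P Set.univ) (emb P z) (emb P x) := by
  have h := exists_isStableConst (hz.mul_pos hlam) Set.univ x fun j _ => hx j
  have h1 : IsStableConst P lam Set.univ x (stableConst P x lam) := Classical.epsilon_spec h
  exact h1.eq_formula (hz.mul_pos hlam) reflClosed_univ (hasNeg_unitSystem P hneg)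

theorem existsUnique_isStableConst (hneg : NegOneMemWeyl P) {lam : V}
    (hlam : IsDualRegular P lam) {x : X} (hx : IsRegular P x) :
    ∃! n, IsStableConst P lam Set.univ x n := by
  obtain ⟨z, hz⟩ := exists_represents P lam
  obtain ⟨n, hn⟩ := exists_isStableConst (hz.mul_pos hlam) Set.univ x fun j _ => hx j
  refine ⟨n, hn, fun m hm => ?_⟩
  have h := fun {k} (hk : IsStableConst P lam Set.univ x k) =>
    hk.eq_formula (hz.mul_pos hlam) reflClosed_univ (hasNeg_unitSystem P hneg)
  exact Int.cast_injective (α := ℂ) ((h hm).trans (h hn).symm)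

/-- The dependence on the orbit of `lam` reduces to the dependence on the orbit of `x`. -/
theorem stableConst_smul (hneg : NegOneMemWeyl P) {lam : V} (hlam : IsDualRegular P lam) {x : X}
    (hx : IsRegular P x) {w : P.Aut} (hw : w ∈ P.weylGroup) :
    stableConst P x (w • lam) = stableConst P (act P w⁻¹ x) lam := by
  obtain ⟨z, hz⟩ := exists_represents P lam
  apply Int.cast_injective (α := ℂ)
  rw [stableConst_eq hneg (hz.smul hw) (hlam.smul hw) hx,
    stableConst_eq hneg hz hlam (IsRegular.act P hx _)]
  obtain ⟨u, hu, hu'⟩ := exists_reflGroup_emb P hw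
  have h : emb P x = u (emb P (act P w⁻¹ x)) := by rw [← hu', ← act_mul, mul_inv_cancel, act_one]
  rw [hu', h, (reflClosed_univ (P := P)).isUnitSystem.formula_apply hu]

theorem exists_equiv_refl (x : X) {a : EuclideanSpace ℝ ι} (ha : a ∈ unitSystem P Set.univ) :
    ∃ r : P.weylGroup ≃ P.weylGroup, ∀ w : P.weylGroup,
      emb P (act P (r w).1 x) = refl a (emb P (act P w.1 x)) := by
  obtain ⟨j, -, rfl⟩ := (mem_unitSystem P).1 ha
  refine ⟨Equiv.mulLeft (RootPairing.weylGroup.ofIdx P j), fun w => ?_⟩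
  rw [refl_unitCoroot_emb, ← act_reflection, ← act_mul]
  rfl

theorem sum_stableConst (hneg : NegOneMemWeyl P) {lam : V} (hlam : IsDualRegular P lam) {x : X}
    (hx : IsRegular P x) :
    ∑ w : P.weylGroup, stableConst P (act P w.1 x) lam = (Nat.card P.weylGroup : ℤ) := by
  obtain ⟨z, hz⟩ := exists_represents P lam
  have h := (reflClosed_univ (P := P)).isUnitSystem.sum_formula (hasNeg_unitSystem P hneg)
    (regular_emb P (hz.isRegular hlam)) (ξ := fun w : P.weylGroup => emb P (act P w.1 x))
    (fun w => regular_emb P (IsRegular.act P hx _)) fun a ha => exists_equiv_refl x ha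
  apply Int.cast_injective (α := ℂ)
  rw [Int.cast_sum, Nat.card_eq_fintype_card, Int.cast_natCast, ← h]
  exact Finset.sum_congr rfl fun w _ => stableConst_eq hneg hz hlam (IsRegular.act P hx _)

/-- The product of the signs of the positive roots transforms by the sign character. -/
theorem prod_sg_act {L x : X} (hL : IsRegular P L) (hx : IsRegular P x) {w : P.Aut}
    (hw : w ∈ P.weylGroup) :
    ∏ b ∈ pos (unitSystem P Set.univ) (emb P L), sg ⟪b, emb P (act P w x)⟫
      = eps P w * ∏ b ∈ pos (unitSystem P Set.univ) (emb P L), sg ⟪b, emb P x⟫ := by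
  have := finiteDimensional_of_isRootSystem P
  have hΦ := (reflClosed_univ (P := P)).isUnitSystem
  induction hw using RootPairing.weylGroup.induction generalizing x with
  | mem i =>
    have hi : unitCoroot P i ∈ unitSystem P Set.univ := (mem_unitSystem P).2 ⟨i, trivial, rfl⟩
    rw [act_reflection, ← refl_unitCoroot_emb, eps_reflection,
      hΦ.prod_sg_refl (Finset.Subset.refl _) (fun b hb => hΦ.neg_mem hb) hi
        (fun b hb => hΦ.refl_mem _ hi b hb) (regular_emb P hL) (regular_emb P hx)]
    push_cast
    ring
  | one => rw [act_one, eps_one]; simp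
  | mul w w' hw hw' h h' =>
    rw [act_mul, h (IsRegular.act P hx w'), h' hx, eps_mul]
    push_cast
    ring

theorem finrank_span_unitSystem :
    finrank ℝ (Submodule.span ℝ (unitSystem P Set.univ : Set (EuclideanSpace ℝ ι)))
      = finrank ℝ X := by
  have h : Submodule.span ℝ (unitSystem P Set.univ : Set (EuclideanSpace ℝ ι))
      = LinearMap.range (emb P) := by
    apply le_antisymm
    · rw [Submodule.span_le]
      intro b hb
      obtain ⟨j, -, rfl⟩ := (mem_unitSystem P).1 hb
      exact Submodule.smul_mem _ _ ⟨_, rfl⟩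
    · rw [LinearMap.range_eq_map, ← RootPairing.IsRootSystem.span_coroot_eq_top (P := P),
        Submodule.map_span, Submodule.span_le]
      rintro _ ⟨_, ⟨j, rfl⟩, rfl⟩
      have h1 : unitCoroot P j ∈ Submodule.span ℝ
          (unitSystem P Set.univ : Set (EuclideanSpace ℝ ι)) :=
        Submodule.subset_span ((mem_unitSystem P).2 ⟨j, trivial, rfl⟩)
      have h2 := Submodule.smul_mem _ ‖emb P (P.coroot j)‖ h1
      rwa [unitCoroot, smul_inv_smul₀ (norm_emb_coroot_pos P j).ne'] at h2
  rw [h, LinearMap.finrank_range_of_inj (emb_injective P)]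

theorem card_pos_unitSystem [P.IsReduced] (x : X) :
    (pos (unitSystem P Set.univ) (emb P x)).card = {i | 0 < P.root' i x}.ncard := by
  classical
  have h : (pos (unitSystem P Set.univ) (emb P x) : Set (EuclideanSpace ℝ ι))
      = unitCoroot P '' {i | 0 < P.root' i x} := by
    ext b
    rw [Finset.mem_coe, mem_pos, mem_unitSystem]
    constructor
    · rintro ⟨⟨j, -, rfl⟩, hj⟩
      exact ⟨j, (inner_unitCoroot_pos P).1 hj, rfl⟩
    · rintro ⟨j, hj, rfl⟩
      exact ⟨⟨j, trivial, rfl⟩, (inner_unitCoroot_pos P).2 hj⟩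
  rw [← Set.ncard_coe_finset, h, Set.InjOn.ncard_image]
  intro i hi j hj hij
  have hm : P.root j ∈ Submodule.span ℝ {P.root i} := (unitCoroot_eq_or_eq_neg P).2 (Or.inl hij.symm)
  obtain ⟨c, hc⟩ := Submodule.mem_span_singleton.1 hm
  have hdep : ¬ LinearIndependent ℝ ![P.root i, P.root j] := by
    rw [LinearIndependent.pair_iff]
    intro h
    have := (h c (-1) (by rw [hc]; simp)).2
    norm_num at this
  by_contra hne
  rcases RootPairing.IsReduced.eq_or_eq_neg (P := P) i j hdep with h1 | h1
  · exact hne (P.root.injective h1)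
  · have h2 : P.root' i x = -P.root' j x := by
      change P.toLinearMap (P.root i) x = -P.toLinearMap (P.root j) x
      rw [h1]
      simp
    have hi' : 0 < P.root' i x := hi
    have hj' : 0 < P.root' j x := hj
    linarith

/-- A power of `I` whose multiple by a positive number is real has an even exponent. -/
theorem I_pow_eq_of_mul_eq {N m : ℕ} {r : ℝ} (hm : m ≠ 0) (h : (r : ℂ) = Complex.I ^ N * m) :
    r = (-1) ^ (N / 2) * m := by
  rcases Nat.even_or_odd' N with ⟨k, rfl | rfl⟩
  · rw [pow_mul, Complex.I_sq] at h
    rw [Nat.mul_div_cancel_left k two_pos]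
    exact_mod_cast h
  · exfalso
    rw [pow_succ, pow_mul, Complex.I_sq] at h
    have h1 : (r : ℂ) = ((-1) ^ k * m : ℝ) * Complex.I := by rw [h]; push_cast; ring
    have h2 := congrArg Complex.im h1
    rw [Complex.ofReal_im, Complex.im_ofReal_mul, Complex.I_im, mul_one] at h2
    have h3 : (m : ℝ) ≠ 0 := Nat.cast_ne_zero.2 hm
    exact mul_ne_zero (pow_ne_zero k (by norm_num)) h3 h2.symm

theorem sum_eps_mul_stableConst [P.IsReduced] (hneg : NegOneMemWeyl P) {lam : V}
    (hlam : IsDualRegular P lam) {x : X} (hx : IsRegular P x) (hdual : InDualChamber P x lam) :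
    ∑ w : P.weylGroup, eps P w.1 * (stableConst P (act P w.1 x) lam : ℝ)
      = (-1) ^ qR P x * (Nat.card P.weylGroup : ℝ) := by
  obtain ⟨z, hz⟩ := exists_represents P lam
  have hzr := hz.isRegular hlam
  have hsign : ∀ j, 0 < P.root' j z ↔ 0 < P.root' j x := by
    intro j
    rw [← hz.coroot'_pos]
    refine ⟨fun h => ?_, hdual j⟩
    by_contra hj
    have hj' : P.root' j x < 0 := lt_of_le_of_ne (not_lt.1 hj) (hx j)
    have h1 := hdual (P.reflectionPerm j j) (by
      change 0 < P.toLinearMap (P.root _) x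
      rw [P.root_reflectionPerm, P.reflection_apply_self, map_neg, LinearMap.neg_apply]
      exact neg_pos.2 hj')
    have h2 : P.coroot' (P.reflectionPerm j j) lam = -P.coroot' j lam := by
      change P.toLinearMap lam (P.coroot _) = -P.toLinearMap lam (P.coroot j)
      rw [P.coroot_reflectionPerm, P.coreflection_apply_self, map_neg]
    rw [h2] at h1
    linarith
  have hone : ∏ b ∈ pos (unitSystem P Set.univ) (emb P z), sg ⟪b, emb P x⟫ = 1 := by
    refine Finset.prod_eq_one fun b hb => ?_
    obtain ⟨hb, hb'⟩ := mem_pos.1 hb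
    obtain ⟨j, -, rfl⟩ := (mem_unitSystem P).1 hb
    exact sg_of_pos ((inner_unitCoroot_pos P).2 ((hsign j).1 ((inner_unitCoroot_pos P).1 hb')))
  have h := (reflClosed_univ (P := P)).isUnitSystem.sum_sign_mul_formula
    (regular_emb P hzr) (ξ := fun w : P.weylGroup => emb P (act P w.1 x))
    (fun w => regular_emb P (IsRegular.act P hx _)) fun a ha => exists_equiv_refl x ha
  have hset : {i | 0 < P.root' i z} = {i | 0 < P.root' i x} := Set.ext hsign
  rw [finrank_span_unitSystem, card_pos_unitSystem, hset] at h
  rw [Nat.card_eq_fintype_card]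
  refine I_pow_eq_of_mul_eq Fintype.card_ne_zero (Eq.trans ?_ h)
  rw [Complex.ofReal_sum]
  refine Finset.sum_congr rfl fun w _ => ?_
  rw [prod_sg_act hzr hx w.2, hone, mul_one, Complex.ofReal_mul, Complex.ofReal_intCast,
    stableConst_eq hneg hz hlam (IsRegular.act P hx _)]

end StableConstants

end

theorem proposition1 {ι V X : Type*} [Finite ι] [AddCommGroup V] [Module ℝ V]
    [AddCommGroup X] [Module ℝ X] (P : RootPairing ι ℝ V X)
    [P.IsRootSystem] [P.IsCrystallographic] (hneg : StableConstants.NegOneMemWeyl P)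
    (x₀ : X) (hx₀ : StableConstants.IsRegular P x₀)
    (lam : V) (hlam : StableConstants.IsDualRegular P lam) :
    -- the rules determine a unique integer
    (∃! n : ℤ, StableConstants.IsStableConst P lam Set.univ x₀ n) ∧
    -- (i), for the orbit of `x₀` and for the orbit of `lam`
    (∑ w : P.weylGroup, StableConstants.stableConst P (StableConstants.act P w.1 x₀) lam
        = (Nat.card P.weylGroup : ℤ)) ∧
    (∑ w : P.weylGroup, StableConstants.stableConst P x₀ (w.1 • lam)
        = (Nat.card P.weylGroup : ℤ)) ∧
    -- (ii), for the orbit of `x₀` and for the orbit of `lam`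
    (P.IsReduced → StableConstants.InDualChamber P x₀ lam →
      (∑ w : P.weylGroup, StableConstants.eps P w.1 *
          (StableConstants.stableConst P (StableConstants.act P w.1 x₀) lam : ℝ)
        = (-1) ^ StableConstants.qR P x₀ * (Nat.card P.weylGroup : ℝ)) ∧
      (∑ w : P.weylGroup, StableConstants.eps P w.1 *
          (StableConstants.stableConst P x₀ (w.1 • lam) : ℝ)
        = (-1) ^ StableConstants.qR P x₀ * (Nat.card P.weylGroup : ℝ))) := by
  have := Fintype.ofFinite ι
  have := StableConstants.finiteDimensional_of_isRootSystem P
  refine ⟨StableConstants.existsUnique_isStableConst hneg hlam hx₀,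
    StableConstants.sum_stableConst hneg hlam hx₀, ?_, fun hred hdual => ⟨?_, ?_⟩⟩
  · rw [← StableConstants.sum_stableConst hneg hlam hx₀, ← Equiv.sum_comp (Equiv.inv _)]
    exact Finset.sum_congr rfl fun w _ => by
      rw [StableConstants.stableConst_smul hneg hlam hx₀ (Equiv.inv _ w).2]
      simp
  · exact StableConstants.sum_eps_mul_stableConst hneg hlam hx₀ hdual
  · rw [← StableConstants.sum_eps_mul_stableConst hneg hlam hx₀ hdual,
      ← Equiv.sum_comp (Equiv.inv _)]
    exact Finset.sum_congr rfl fun w _ => by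
      rw [StableConstants.stableConst_smul hneg hlam hx₀ (Equiv.inv _ w).2,
        ← StableConstants.eps_inv P (Equiv.inv _ w).2]
      simp
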